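/- Theorem 1. For $m\ge 1$ let $S_m$ be the $m\times m$ complex symmetric matrix with entries $$(S_m)_{pq}=\tfrac12[\,|p-q|=1\,]+\tfrac i2[\,p+q=m+2\,]-\tfrac i2[\,p+q=m\,]\qquad(1\le p,q\le m),$$ where $[\cdot]$ is $1$ if the condition holds and $0$ otherwise ($S_m$ is the nilpotent symmetric Jordan block: it is similar to the nilpotent $m\times m$ Jordan block). For $k\ge 0$ let $K_k$ be the $(k+1)\times k$ matrix formed by the odd-numbered rows and the even-numbered columns of $S_{2k+1}$. Consider square blocks of two kinds: 1. for $m\ge1$ and $\lambda\in\mathbb C$, the $m\times m$ symmetric Jordan block $J_m(\lambda)=\lambda I_m+S_m$; 2. for $m\ge 1$ and $0\le m_1\le m-1$, the $m\times m$ degenerate block $D_{m_1,m-m_1-1}$ with upper left $(m_1+1)\times m_1$ part $K_{m_1}$, lower right $(m-m_1-1)\times(m-m_1)$ part $K_{m-m_1-1}^T$, and zeros elsewhere. Let $n\ge 0$ and let $R$ be a complex $n\times n$ matrix. Then there are complex orthogonal $n\times n$ matrices $O_1,O_2$ (that is, $O_i^TO_i=I$) such that $O_1RO_2$ is a direct sum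 of blocks of these two kinds. This direct sum is unique in the following sense. To a direct sum of blocks assign the multiset of its constituents: the constituents of $D_{k,l}$ are its parts $K_k$ and $K_l^T$; the constituents of $J_{2k+1}(0)$ are also $K_k$ and $K_k^T$ (with $k=l$; $J_{2k+1}(0)$ and $D_{k,k}$ differ only by a permutation of the rows and one of the columns); any other $J_m(\lambda)$ has one constituent, namely the pair $(\{\lambda,-\lambda\},m)$. If $R$ can be brought in this way to one direct sum of blocks, then it can be brought to another one if and only if the two direct sums have the same multiset of constituents. So the direct sum is determined up to the order of the blocks, the signs of the $\lambda$'s, the way in which the parts $K_k$ and $K_l^T$ are paired into degenerate blocks, and the choice between $J_{2k+1}(0)$ and $D_{k,k}$, and all these changes are possible. -/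

import Mathlib

namespace ComplexOrthogonalSVD

open Matrix

/-- The nilpotent symmetric Jordan block `S_m`.  With indices `p, q` running from `1` to `m`, its
entry is `1/2` if `|p - q| = 1`, plus `i/2` if `p + q = m + 2`, minus `i/2` if `p + q = m`.
Equivalently `S_m = B N B⁻¹`, where `N` is the nilpotent upper triangular Jordan block,
`B = (I + i E) / √2` and `E` is the matrix that reverses the order of the coordinates.
(Below the indices start at `0`.) -/
noncomputable def symNilpotent (m : ℕ) : Matrix (Fin m) (Fin m) ℂ :=
  Matrix.of fun p q =>
    (if (p : ℕ) + 1 = q ∨ (q : ℕ) + 1 = p then (1 / 2 : ℂ) else 0)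
      + (if (p : ℕ) + q = m then Complex.I / 2 else 0)
      - (if (p : ℕ) + q + 2 = m then Complex.I / 2 else 0)

/-- The symmetric Jordan block `lam • I_m + S_m`. -/
noncomputable def symJordan (lam : ℂ) (m : ℕ) : Matrix (Fin m) (Fin m) ℂ :=
  lam • (1 : Matrix (Fin m) (Fin m) ℂ) + symNilpotent m

/-- The `(k + 1) × k` matrix formed by the odd rows and the even columns (first, third, … row and
second, fourth, … column) of the `(2 k + 1) × (2 k + 1)` nilpotent symmetric Jordan block. -/
noncomputable def oddEven (k : ℕ) : Matrix (Fin (k + 1)) (Fin k) ℂ :=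
  (symNilpotent (2 * k + 1)).submatrix
    (fun p => ⟨2 * (p : ℕ), by have := p.isLt; omega⟩)
    (fun q => ⟨2 * (q : ℕ) + 1, by have := q.isLt; omega⟩)

/-- The degenerate block of size `m = k + l + 1`: upper left the `(k + 1) × k` matrix `oddEven k`,
lower right the `l × (l + 1)` matrix `(oddEven l)ᵀ`, zero elsewhere.  (Here `k = m₁` and
`l = m - m₁ - 1`, so `2 l + 1 = 2 (m - m₁) - 1`.) -/
noncomputable def degenerateMatrix (k l : ℕ) :
    Matrix (Fin (k + l + 1)) (Fin (k + l + 1)) ℂ :=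
  (Matrix.fromBlocks (oddEven k) 0 0 (oddEven l)ᵀ).reindex
    (finSumFinEquiv.trans (finCongr (by omega)))
    (finSumFinEquiv.trans (finCongr (by omega)))

/-- The two kinds of blocks of the normal form. -/
inductive Block where
  /-- the symmetric Jordan block `lam • I_m + S_m`, of size `m ≥ 1` -/
  | jordan (lam : ℂ) (m : ℕ) (hm : 1 ≤ m) : Block
  /-- the degenerate block of size `k + l + 1` -/
  | degenerate (k l : ℕ) : Block

/-- The size `m` of an `m × m` block. -/
def Block.size : Block → ℕ
  | .jordan _ m _ => m
  | .degenerate k l => k + l + 1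

/-- The matrix of a block. -/
noncomputable def Block.toMatrix : (b : Block) → Matrix (Fin b.size) (Fin b.size) ℂ
  | .jordan lam m _ => symJordan lam m
  | .degenerate k l => degenerateMatrix k l

/-- The size of the direct sum of a list of blocks. -/
def totalSize : List Block → ℕ
  | [] => 0
  | b :: L => b.size + totalSize L

/-- The direct sum (block diagonal matrix) of a list of blocks, in the order of the list. -/
noncomputable def directSum : (L : List Block) → Matrix (Fin (totalSize L)) (Fin (totalSize L)) ℂ
  | [] => 0
  | b :: L =>
    (Matrix.fromBlocks b.toMatrix 0 0 (directSum L)).reindex finSumFinEquiv finSumFinEquiv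

/-- `HasForm R L`: there are complex orthogonal matrices `O₁`, `O₂` such that `O₁ R O₂` is the
direct sum of the blocks in `L`. -/
def HasForm {n : ℕ} (R : Matrix (Fin n) (Fin n) ℂ) (L : List Block) : Prop :=
  ∃ (h : totalSize L = n) (O₁ O₂ : Matrix (Fin n) (Fin n) ℂ),
    O₁ᵀ * O₁ = 1 ∧ O₂ᵀ * O₂ = 1 ∧
      O₁ * R * O₂ = (directSum L).reindex (finCongr h) (finCongr h)

/-- The constituents of blocks that a matrix determines. -/
inductive Part where
  /-- a symmetric Jordan block of size `m` with parameter `lam` or `-lam`, where `lam ^ 2 = mu` -/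
  | jordan (mu : ℂ) (m : ℕ) : Part
  /-- a `(k + 1) × k` part `oddEven k` -/
  | tall (k : ℕ) : Part
  /-- an `l × (l + 1)` part `(oddEven l)ᵀ` -/
  | wide (l : ℕ) : Part

open Classical in
/-- The constituents of a block.  A degenerate block has its two parts as constituents.  A
symmetric Jordan block is its own constituent, with `lam` taken up to sign, except that a nilpotent
one of odd size `2 k + 1`, which is the degenerate block with parts `oddEven k`, `(oddEven k)ᵀ` up
to a permutation of the rows and one of the columns, has these two parts as constituents. -/
noncomputable def Block.parts : Block → Multiset Part
  | .jordan lam m _ =>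
    if lam = 0 ∧ Odd m then {Part.tall (m / 2), Part.wide (m / 2)} else {Part.jordan (lam ^ 2) m}
  | .degenerate k l => {Part.tall k, Part.wide l}

/-- All constituents of a list of blocks, counted with multiplicity. -/
noncomputable def parts (L : List Block) : Multiset Part :=
  (L.map Block.parts).sum

end ComplexOrthogonalSVD

/-! View `R` as a pair of opposite maps `R`, `Rᵀ` between two spaces with nondegenerate symmetric
bilinear forms. The crux is that the forms can be forgotten: if `(R, Rᵀ)` and `(R', R'ᵀ)` are
isomorphic as pairs of linear maps, then `R` and `R'` are orthogonally equivalent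
(`OrthEquiv.of_pairEquiv`). An isomorphism is corrected to an orthogonal one as in a polar
decomposition. The Gram matrices on the two sides are intertwined by the block, so square roots of
them given by one common polynomial are intertwined too, and can be divided out
(`exists_common_sqrt`, `exists_normalize`).

The same correction works for frames that span only nondegenerate subspaces, and then splits off an
orthogonal summand (`exists_orthEquiv_fromBlocks_of_pairEquiv`). For existence it thus suffices to
find a chain with invertible Gram matrix on which the pair acts as a model block. A nonzero
eigenvalue of `R * Rᵀ` gives a Jordan block. In the nilpotent case one takes a longest nonzero
alternating product of `R` and `Rᵀ`; its type decides between a tall part, a wide part and an even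
nilpotent Jordan block (`exists_split_part`). Gram matrices of such chains are antitriangular, hence
invertible. The summands may be rectangular, so the induction runs over rectangular matrices, and
tall and wide parts are paired into square blocks at the end (`exists_parts_eq`).

For uniqueness, the ranks of `(R * Rᵀ - mu) ^ j`, `(Rᵀ * R) ^ j` and `(R * Rᵀ) ^ j * R` are
invariants, additive over direct sums, and suitable alternating sums of them count each part
(`multiplicity_part`). Conversely, each block is orthogonally equivalent to the direct sum of its
constituents, so equal multisets give equivalent direct sums. -/

namespace ComplexOrthogonalSVD

open Matrix Polynomial

/-! ### Orthogonal equivalence and isomorphism of pairs -/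

section Equivalence

variable {m n m' n' m'' n'' a b c d : Type}
  [Fintype m] [Fintype n] [Fintype m'] [Fintype n'] [Fintype m''] [Fintype n'']
  [Fintype a] [Fintype b] [Fintype c] [Fintype d]
  [DecidableEq m] [DecidableEq n] [DecidableEq m'] [DecidableEq n']
  [DecidableEq m''] [DecidableEq n'']
  [DecidableEq a] [DecidableEq b] [DecidableEq c] [DecidableEq d]

/-- Two rectangular matrices are orthogonally equivalent if they differ by complex orthogonal
changes of coordinates on both sides. -/
def OrthEquiv (R : Matrix m n ℂ) (R' : Matrix m' n' ℂ) : Prop :=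
  ∃ (P : Matrix m' m ℂ) (Q : Matrix n' n ℂ),
    Pᵀ * P = 1 ∧ P * Pᵀ = 1 ∧ Qᵀ * Q = 1 ∧ Q * Qᵀ = 1 ∧ P * R = R' * Q

theorem OrthEquiv.refl (R : Matrix m n ℂ) : OrthEquiv R R :=
  ⟨1, 1, by simp, by simp, by simp, by simp, by simp⟩

theorem OrthEquiv.symm {R : Matrix m n ℂ} {R' : Matrix m' n' ℂ} (h : OrthEquiv R R') :
    OrthEquiv R' R := by
  obtain ⟨P, Q, h1, h2, h3, h4, h5⟩ := h
  refine ⟨Pᵀ, Qᵀ, by simpa using h2, by simpa using h1, by simpa using h4, by simpa using h3, ?_⟩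
  calc Pᵀ * R' = Pᵀ * (R' * Q) * Qᵀ := by simp [Matrix.mul_assoc, h4]
    _ = (Pᵀ * P) * R * Qᵀ := by rw [← h5]; simp [Matrix.mul_assoc]
    _ = R * Qᵀ := by rw [h1, Matrix.one_mul]

theorem OrthEquiv.trans {R : Matrix m n ℂ} {R' : Matrix m' n' ℂ} {R'' : Matrix m'' n'' ℂ}
    (h : OrthEquiv R R') (h' : OrthEquiv R' R'') : OrthEquiv R R'' := by
  obtain ⟨P, Q, h1, h2, h3, h4, h5⟩ := h
  obtain ⟨P', Q', k1, k2, k3, k4, k5⟩ := h'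
  refine ⟨P' * P, Q' * Q, ?_, ?_, ?_, ?_, ?_⟩
  · rw [transpose_mul, Matrix.mul_assoc, ← Matrix.mul_assoc P'ᵀ, k1, Matrix.one_mul, h1]
  · rw [transpose_mul, Matrix.mul_assoc, ← Matrix.mul_assoc P, h2, Matrix.one_mul, k2]
  · rw [transpose_mul, Matrix.mul_assoc, ← Matrix.mul_assoc Q'ᵀ, k3, Matrix.one_mul, h3]
  · rw [transpose_mul, Matrix.mul_assoc, ← Matrix.mul_assoc Q, h4, Matrix.one_mul, k4]
  · rw [Matrix.mul_assoc, h5, ← Matrix.mul_assoc, k5, Matrix.mul_assoc]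

theorem OrthEquiv.transpose {R : Matrix m n ℂ} {R' : Matrix m' n' ℂ} (h : OrthEquiv R R') :
    OrthEquiv Rᵀ R'ᵀ := by
  obtain ⟨P, Q, h1, h2, h3, h4, h5⟩ := h.symm
  refine ⟨Qᵀ, Pᵀ, by simpa using h4, by simpa using h3, by simpa using h2, by simpa using h1, ?_⟩
  rw [← transpose_mul, ← transpose_mul, h5]

theorem OrthEquiv.card_rows {R : Matrix m n ℂ} {R' : Matrix m' n' ℂ} (h : OrthEquiv R R') :
    Fintype.card m = Fintype.card m' := by
  obtain ⟨P, Q, h1, h2, -⟩ := h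
  have k1 : (1 : Matrix m m ℂ).rank ≤ (1 : Matrix m' m' ℂ).rank := by
    rw [← h1]
    exact (rank_mul_le_right _ _).trans (by simpa using P.rank_le_card_height)
  have k2 : (1 : Matrix m' m' ℂ).rank ≤ (1 : Matrix m m ℂ).rank := by
    rw [← h2]
    exact (rank_mul_le_left _ _).trans (by simpa using P.rank_le_card_width)
  simp only [rank_one] at k1 k2
  omega

theorem OrthEquiv.card_cols {R : Matrix m n ℂ} {R' : Matrix m' n' ℂ} (h : OrthEquiv R R') :
    Fintype.card n = Fintype.card n' := h.transpose.card_rows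

theorem OrthEquiv.reindex (R : Matrix m n ℂ) (e : m ≃ m') (f : n ≃ n') :
    OrthEquiv R (R.reindex e f) := by
  refine ⟨(1 : Matrix m m ℂ).submatrix e.symm id, (1 : Matrix n n ℂ).submatrix f.symm id,
    ?_, ?_, ?_, ?_, ?_⟩
  · ext i j; simp [Matrix.mul_apply, Matrix.one_apply]
    rw [Finset.sum_eq_single (e i)]
    · simp
    · simp +contextual only [Equiv.symm_apply_eq]
      rintro b - hb
      split_ifs <;> simp_all
    · simp
  · ext i j; simp [Matrix.mul_apply, Matrix.one_apply]
  · ext i j; simp [Matrix.mul_apply, Matrix.one_apply]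
    rw [Finset.sum_eq_single (f i)]
    · simp
    · simp +contextual only [Equiv.symm_apply_eq]
      rintro b - hb
      split_ifs <;> simp_all
    · simp
  · ext i j; simp [Matrix.mul_apply, Matrix.one_apply]
  · ext i j; simp [Matrix.mul_apply, Matrix.one_apply]
    rw [Finset.sum_eq_single (f j)] <;> simp +contextual [Equiv.symm_apply_eq]

theorem OrthEquiv.of_isEmpty [IsEmpty m] [IsEmpty n] [IsEmpty m'] [IsEmpty n']
    (R : Matrix m n ℂ) (R' : Matrix m' n' ℂ) : OrthEquiv R R' :=
  ⟨0, 0, by ext i; exact isEmptyElim i, by ext i; exact isEmptyElim i,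
    by ext i; exact isEmptyElim i, by ext i; exact isEmptyElim i, by ext i; exact isEmptyElim i⟩

theorem OrthEquiv.fromBlocks {A : Matrix m n ℂ} {A' : Matrix m' n' ℂ} {B : Matrix a b ℂ}
    {B' : Matrix c d ℂ} (h : OrthEquiv A A') (h' : OrthEquiv B B') :
    OrthEquiv (fromBlocks A 0 0 B) (fromBlocks A' 0 0 B') := by
  obtain ⟨P, Q, h1, h2, h3, h4, h5⟩ := h
  obtain ⟨P', Q', k1, k2, k3, k4, k5⟩ := h'
  refine ⟨Matrix.fromBlocks P 0 0 P', Matrix.fromBlocks Q 0 0 Q', ?_, ?_, ?_, ?_, ?_⟩ <;>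
    simp [fromBlocks_transpose, fromBlocks_multiply, *]

theorem OrthEquiv.fromBlocks_comm (A : Matrix m n ℂ) (B : Matrix a b ℂ) :
    OrthEquiv (Matrix.fromBlocks A 0 0 B) (Matrix.fromBlocks B 0 0 A) := by
  convert OrthEquiv.reindex (Matrix.fromBlocks A 0 0 B) (Equiv.sumComm m a) (Equiv.sumComm n b)
    using 1
  ext (i | i) (j | j) <;> simp

theorem OrthEquiv.fromBlocks_assoc (A : Matrix m n ℂ) (B : Matrix a b ℂ) (C : Matrix c d ℂ) :
    OrthEquiv (Matrix.fromBlocks (Matrix.fromBlocks A 0 0 B) 0 0 C)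
      (Matrix.fromBlocks A 0 0 (Matrix.fromBlocks B 0 0 C)) := by
  convert OrthEquiv.reindex (Matrix.fromBlocks (Matrix.fromBlocks A 0 0 B) 0 0 C)
    (Equiv.sumAssoc m a c) (Equiv.sumAssoc n b d) using 1
  ext (i | i | i) (j | j | j) <;> simp

/-- Two pairs of opposite maps are isomorphic if they differ by changes of coordinates on both
spaces. -/
def PairEquiv (F : Matrix m n ℂ) (G : Matrix n m ℂ) (F' : Matrix m' n' ℂ) (G' : Matrix n' m' ℂ) :
    Prop :=
  ∃ (P : Matrix m' m ℂ) (P' : Matrix m m' ℂ) (Q : Matrix n' n ℂ) (Q' : Matrix n n' ℂ),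
    P' * P = 1 ∧ P * P' = 1 ∧ Q' * Q = 1 ∧ Q * Q' = 1 ∧ P * F = F' * Q ∧ Q * G = G' * P

/-- The easy half of the principle that forms can be forgotten; the converse is
`OrthEquiv.of_pairEquiv`. -/
theorem OrthEquiv.pairEquiv {R : Matrix m n ℂ} {R' : Matrix m' n' ℂ} (h : OrthEquiv R R') :
    PairEquiv R Rᵀ R' R'ᵀ := by
  obtain ⟨P, Q, h1, h2, h3, h4, h5⟩ := h
  refine ⟨P, Pᵀ, Q, Qᵀ, h1, h2, h3, h4, h5, ?_⟩
  have h6 : Rᵀ * Pᵀ = Qᵀ * R'ᵀ := by rw [← transpose_mul, h5, transpose_mul]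
  calc Q * Rᵀ = Q * (Rᵀ * Pᵀ) * P := by simp [Matrix.mul_assoc, h1]
    _ = (Q * Qᵀ) * R'ᵀ * P := by rw [h6]; simp [Matrix.mul_assoc]
    _ = R'ᵀ * P := by rw [h4, Matrix.one_mul]

theorem PairEquiv.symm {F : Matrix m n ℂ} {G : Matrix n m ℂ} {F' : Matrix m' n' ℂ}
    {G' : Matrix n' m' ℂ} (h : PairEquiv F G F' G') : PairEquiv F' G' F G := by
  obtain ⟨P, P', Q, Q', h1, h2, h3, h4, h5, h6⟩ := h
  refine ⟨P', P, Q', Q, h2, h1, h4, h3, ?_, ?_⟩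
  · calc P' * F' = P' * (F' * Q) * Q' := by simp [Matrix.mul_assoc, h4]
      _ = (P' * P) * F * Q' := by rw [← h5]; simp [Matrix.mul_assoc]
      _ = F * Q' := by rw [h1, Matrix.one_mul]
  · calc Q' * G' = Q' * (G' * P) * P' := by simp [Matrix.mul_assoc, h2]
      _ = (Q' * Q) * G * P' := by rw [← h6]; simp [Matrix.mul_assoc]
      _ = G * P' := by rw [h3, Matrix.one_mul]

theorem PairEquiv.trans {F : Matrix m n ℂ} {G : Matrix n m ℂ} {F' : Matrix m' n' ℂ}
    {G' : Matrix n' m' ℂ} {F'' : Matrix m'' n'' ℂ} {G'' : Matrix n'' m'' ℂ}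
    (h : PairEquiv F G F' G') (k : PairEquiv F' G' F'' G'') : PairEquiv F G F'' G'' := by
  obtain ⟨P, P', Q, Q', h1, h2, h3, h4, h5, h6⟩ := h
  obtain ⟨S, S', T, T', k1, k2, k3, k4, k5, k6⟩ := k
  refine ⟨S * P, P' * S', T * Q, Q' * T', ?_, ?_, ?_, ?_, ?_, ?_⟩
  · rw [Matrix.mul_assoc, ← Matrix.mul_assoc S', k1, Matrix.one_mul, h1]
  · rw [Matrix.mul_assoc, ← Matrix.mul_assoc P, h2, Matrix.one_mul, k2]
  · rw [Matrix.mul_assoc, ← Matrix.mul_assoc T', k3, Matrix.one_mul, h3]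
  · rw [Matrix.mul_assoc, ← Matrix.mul_assoc Q, h4, Matrix.one_mul, k4]
  · rw [Matrix.mul_assoc, h5, ← Matrix.mul_assoc, k5, Matrix.mul_assoc]
  · rw [Matrix.mul_assoc, h6, ← Matrix.mul_assoc, k6, Matrix.mul_assoc]

theorem PairEquiv.swap {F : Matrix m n ℂ} {G : Matrix n m ℂ} {F' : Matrix m' n' ℂ}
    {G' : Matrix n' m' ℂ} (h : PairEquiv F G F' G') : PairEquiv G F G' F' := by
  obtain ⟨P, P', Q, Q', h1, h2, h3, h4, h5, h6⟩ := h
  exact ⟨Q, Q', P, P', h3, h4, h1, h2, h6, h5⟩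

end Equivalence

/-! ### Polynomial square roots of invertible matrices -/

section SquareRoot

/-- A Hensel-type argument, one root at a time: if `p ^ 2 - X = g * h`, then replacing `p` by `p + t
* g` replaces `h` by `h + 2 * t * p + t ^ 2 * g`, and the constant `t` is chosen so that this
vanishes at the new root. -/
theorem exists_prod_dvd_sq_sub_X (s : Multiset ℂ) (hs : (0 : ℂ) ∉ s) :
    ∃ p : ℂ[X], (s.map fun r => X - C r).prod ∣ p ^ 2 - X := by
  induction s using Multiset.induction_on with
  | empty => exact ⟨0, by simp⟩
  | cons r s ih =>
    simp only [Multiset.mem_cons, not_or] at hs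
    obtain ⟨p, h, hp⟩ := ih hs.2
    set g := (s.map fun r => X - C r).prod with hg
    obtain ⟨t, ht⟩ : ∃ t : ℂ, h.eval r + 2 * t * p.eval r + t ^ 2 * g.eval r = 0 := by
      -- At a repeated root the equation for `t` is linear, and solvable because `p(r) ^ 2 = r ≠ 0`;
      -- otherwise it is a genuine quadratic.
      by_cases hgr : g.eval r = 0
      · have hpr : p.eval r ≠ 0 := by
          intro h0
          have := congrArg (eval r) hp
          simp [hgr, h0] at this
          exact hs.1 this.symm
        refine ⟨-(h.eval r) / (2 * p.eval r), ?_⟩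
        rw [hgr]; field_simp; ring
      · obtain ⟨w, hw⟩ := IsAlgClosed.exists_pow_nat_eq
          (discrim (g.eval r) (2 * p.eval r) (h.eval r)) (n := 2) (by norm_num)
        obtain ⟨t, ht⟩ := exists_quadratic_eq_zero hgr ⟨w, by rw [← hw, sq]⟩
        exact ⟨t, by linear_combination ht⟩
    have hdvd : X - C r ∣ h + 2 * C t * p + C t ^ 2 * g := by
      rw [dvd_iff_isRoot]
      simpa using ht
    refine ⟨p + C t * g, ?_⟩
    rw [Multiset.map_cons, Multiset.prod_cons, ← hg]
    have : (p + C t * g) ^ 2 - X = (h + 2 * C t * p + C t ^ 2 * g) * g := by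
      linear_combination hp
    rw [this]
    exact mul_dvd_mul_right hdvd _

theorem exists_dvd_sq_sub_X (f : ℂ[X]) (hf : f.eval 0 ≠ 0) : ∃ p : ℂ[X], f ∣ p ^ 2 - X := by
  have hf0 : f ≠ 0 := by rintro rfl; simp at hf
  obtain ⟨p, hp⟩ := exists_prod_dvd_sq_sub_X f.roots (by
    intro h; exact hf (by simpa using (mem_roots hf0).1 h))
  refine ⟨p, ?_⟩
  have := (IsAlgClosed.splits f).eq_prod_roots
  rw [this]
  have hu : IsUnit (C f.leadingCoeff) := by simpa using hf0
  rwa [hu.mul_left_dvd]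

/-- Using the same `p` for both matrices is the point: whatever intertwines `S` and `T` then also
intertwines their square roots. -/
theorem exists_common_sqrt {a b : Type} [Fintype a] [Fintype b] [DecidableEq a] [DecidableEq b]
    (S : Matrix a a ℂ) (T : Matrix b b ℂ) (hS : IsUnit S.det) (hT : IsUnit T.det) :
    ∃ p : ℂ[X], aeval S p ^ 2 = S ∧ aeval T p ^ 2 = T := by
  obtain ⟨p, hp⟩ := exists_dvd_sq_sub_X (S.charpoly * T.charpoly) (by
    rw [eval_mul, Matrix.eval_charpoly, Matrix.eval_charpoly]
    simp [Matrix.det_neg, hS.ne_zero, hT.ne_zero])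
  refine ⟨p, ?_, ?_⟩
  · obtain ⟨k, hk⟩ := (dvd_mul_right _ _).trans hp
    have := congrArg (aeval S) hk
    rw [map_mul, Matrix.aeval_self_charpoly, zero_mul] at this
    simpa [sub_eq_zero] using this
  · obtain ⟨k, hk⟩ := (dvd_mul_left _ _).trans hp
    have := congrArg (aeval T) hk
    rw [map_mul, Matrix.aeval_self_charpoly, zero_mul] at this
    simpa [sub_eq_zero] using this

theorem aeval_mul_eq_mul_aeval {a b : Type} [Fintype a] [Fintype b] [DecidableEq a]
    [DecidableEq b] {S : Matrix a a ℂ} {T : Matrix b b ℂ} {B : Matrix a b ℂ} (h : S * B = B * T)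
    (p : ℂ[X]) : aeval S p * B = B * aeval T p := by
  induction p using Polynomial.induction_on' with
  | add p q hp hq => simp [Matrix.add_mul, Matrix.mul_add, hp, hq]
  | monomial k c =>
    have : ∀ k : ℕ, S ^ k * B = B * T ^ k := by
      intro k
      induction k with
      | zero => simp
      | succ k ih => rw [pow_succ, Matrix.mul_assoc, h, ← Matrix.mul_assoc, ih, pow_succ,
          Matrix.mul_assoc]
    simp only [aeval_monomial, Algebra.algebraMap_eq_smul_one, smul_mul_assoc, one_mul,
      Matrix.smul_mul, Matrix.mul_smul, this]

theorem transpose_aeval {a : Type} [Fintype a] [DecidableEq a] {S : Matrix a a ℂ} (h : Sᵀ = S)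
    (p : ℂ[X]) : (aeval S p)ᵀ = aeval S p := by
  induction p using Polynomial.induction_on' with
  | add p q hp hq => simp [hp, hq]
  | monomial k c =>
    simp only [aeval_monomial, Algebra.algebraMap_eq_smul_one, smul_mul_assoc, one_mul,
      Matrix.transpose_smul, Matrix.transpose_pow, h]

end SquareRoot

/-! ### Splitting off orthogonal summands -/

section Splitting

variable {m n a b c d : Type}
  [Fintype m] [Fintype n] [Fintype a] [Fintype b] [Fintype c] [Fintype d]
  [DecidableEq m] [DecidableEq n] [DecidableEq a] [DecidableEq b] [DecidableEq c] [DecidableEq d]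

-- Polar decomposition over ℂ: with `U ^ 2 = Pᵀ * P` and `V ^ 2 = Qᵀ * Q`, the frames `P * U⁻¹` and
-- `Q * V⁻¹` are orthonormal. They still intertwine `R` and `B` because `U * B = B * V`.
omit [DecidableEq m] [DecidableEq n] in
theorem exists_normalize {P : Matrix m a ℂ} {Q : Matrix n b ℂ} {R : Matrix m n ℂ}
    {B : Matrix a b ℂ} (h : R * Q = P * B) (h' : Rᵀ * P = Q * Bᵀ) (hP : IsUnit (Pᵀ * P).det)
    (hQ : IsUnit (Qᵀ * Q).det) :
    ∃ (P₁ : Matrix m a ℂ) (Q₁ : Matrix n b ℂ), P₁ᵀ * P₁ = 1 ∧ Q₁ᵀ * Q₁ = 1 ∧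
      R * Q₁ = P₁ * B ∧ Rᵀ * P₁ = Q₁ * Bᵀ := by
  set S := Pᵀ * P with hS
  set T := Qᵀ * Q with hT
  have hSt : Sᵀ = S := by simp [hS]
  have hTt : Tᵀ = T := by simp [hT]
  have hST : S * B = B * T := by
    have := congrArg Matrix.transpose h'
    simp only [transpose_mul, transpose_transpose] at this
    rw [hS, hT, Matrix.mul_assoc, ← h, ← Matrix.mul_assoc, this, Matrix.mul_assoc]
  obtain ⟨p, hpS, hpT⟩ := exists_common_sqrt S T hP hQ
  set U := aeval S p with hU
  set V := aeval T p with hV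
  have hUt : Uᵀ = U := transpose_aeval hSt p
  have hVt : Vᵀ = V := transpose_aeval hTt p
  have hUV : U * B = B * V := aeval_mul_eq_mul_aeval hST p
  have hUu : IsUnit U.det := by
    rw [← hpS, det_pow] at hP
    exact (isUnit_pow_iff two_ne_zero).1 hP
  have hVu : IsUnit V.det := by
    rw [← hpT, det_pow] at hQ
    exact (isUnit_pow_iff two_ne_zero).1 hQ
  have hUV' : B * V⁻¹ = U⁻¹ * B := by
    calc B * V⁻¹ = U⁻¹ * (U * B) * V⁻¹ := by
          rw [← Matrix.mul_assoc, nonsing_inv_mul _ hUu, Matrix.one_mul]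
      _ = U⁻¹ * B * (V * V⁻¹) := by rw [hUV]; simp only [Matrix.mul_assoc]
      _ = U⁻¹ * B := by rw [mul_nonsing_inv _ hVu, Matrix.mul_one]
  have hUV'' : Bᵀ * U⁻¹ = V⁻¹ * Bᵀ := by
    have := congrArg Matrix.transpose hUV'
    simp only [transpose_mul, transpose_nonsing_inv, hUt, hVt] at this
    exact this.symm
  refine ⟨P * U⁻¹, Q * V⁻¹, ?_, ?_, ?_, ?_⟩
  · rw [transpose_mul, transpose_nonsing_inv, hUt, Matrix.mul_assoc, ← Matrix.mul_assoc Pᵀ,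
      ← hS, ← hpS, sq, Matrix.mul_assoc U, mul_nonsing_inv _ hUu, Matrix.mul_one,
      nonsing_inv_mul _ hUu]
  · rw [transpose_mul, transpose_nonsing_inv, hVt, Matrix.mul_assoc, ← Matrix.mul_assoc Qᵀ,
      ← hT, ← hpT, sq, Matrix.mul_assoc V, mul_nonsing_inv _ hVu, Matrix.mul_one,
      nonsing_inv_mul _ hVu]
  · rw [← Matrix.mul_assoc, h, Matrix.mul_assoc, hUV', Matrix.mul_assoc]
  · rw [← Matrix.mul_assoc, h', Matrix.mul_assoc, hUV'', Matrix.mul_assoc]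

theorem exists_dotProduct_mulVec_ne_zero {Z : Matrix m m ℂ} (hZ : Zᵀ = Z) (h0 : Z ≠ 0) :
    ∃ x, x ⬝ᵥ Z *ᵥ x ≠ 0 := by
  by_contra! h
  apply h0
  ext i j
  have hs : Z j i = Z i j := congrFun (congrFun hZ i) j
  have hd : ∀ i, Z i i = 0 := fun i => by
    simpa using h (Pi.single i 1)
  have := h (Pi.single i 1 + Pi.single j 1)
  simp [Matrix.mulVec_add, hd, hs] at this
  simpa [← two_mul] using this

/-- The projector `1 - P * Pᵀ` is symmetric and nonzero, so its quadratic form has a nonzero value;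
a complex square root of that value normalizes the projected vector. -/
theorem exists_unit_orthogonal {P : Matrix m a ℂ} (h : Pᵀ * P = 1)
    (hc : Fintype.card a < Fintype.card m) : ∃ x : m → ℂ, x ⬝ᵥ x = 1 ∧ Pᵀ *ᵥ x = 0 := by
  set Z := 1 - P * Pᵀ with hZ
  have hPZ : Pᵀ * Z = 0 := by
    rw [hZ, Matrix.mul_sub, ← Matrix.mul_assoc, h]; simp
  have hZt : Zᵀ = Z := by simp [hZ]
  have hZZ : Z * Z = Z := by
    nth_rewrite 1 [hZ]
    rw [Matrix.sub_mul, Matrix.mul_assoc, hPZ]; simp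
  have h0 : Z ≠ 0 := by
    intro h0
    have : P * Pᵀ = 1 := (sub_eq_zero.1 (hZ ▸ h0)).symm
    have hr : (1 : Matrix m m ℂ).rank ≤ Fintype.card a := by
      rw [← this]
      exact (rank_mul_le_left _ _).trans P.rank_le_card_width
    simp at hr
    omega
  obtain ⟨y, hy⟩ := exists_dotProduct_mulVec_ne_zero hZt h0
  have hyy : (Z *ᵥ y) ⬝ᵥ (Z *ᵥ y) = y ⬝ᵥ Z *ᵥ y := by
    rw [Matrix.dotProduct_mulVec, ← Matrix.mulVec_transpose, hZt, Matrix.mulVec_mulVec, hZZ,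
      dotProduct_comm]
  obtain ⟨w, hw⟩ := IsAlgClosed.exists_pow_nat_eq (y ⬝ᵥ Z *ᵥ y) (n := 2) (by norm_num)
  have hw0 : w ≠ 0 := by rintro rfl; exact hy (by simpa using hw.symm)
  refine ⟨w⁻¹ • Z *ᵥ y, ?_, ?_⟩
  · rw [smul_dotProduct, dotProduct_smul, hyy, ← hw]
    simp only [smul_eq_mul]
    field_simp
  · rw [Matrix.mulVec_smul, Matrix.mulVec_mulVec, hPZ]; simp

theorem exists_orthogonal_completion (k : ℕ) : ∀ (a : Type) [Fintype a] [DecidableEq a]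
    (P : Matrix m a ℂ), Pᵀ * P = 1 → Fintype.card m = Fintype.card a + k →
    ∃ P' : Matrix m (Fin k) ℂ, P'ᵀ * P' = 1 ∧ Pᵀ * P' = 0 ∧ P * Pᵀ + P' * P'ᵀ = 1 := by
  induction k with
  | zero =>
    intro a _ _ P h hc
    refine ⟨0, by ext i; exact i.elim0, by simp, ?_⟩
    rw [(mul_eq_one_comm_of_card_eq _ _ _ (by simpa using hc.symm)).1 h]; simp
  | succ k ih =>
    intro a _ _ P h hc
    obtain ⟨x, hx, hPx⟩ := exists_unit_orthogonal h (by omega)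
    have hcol : (replicateCol (Fin 1) x)ᵀ * replicateCol (Fin 1) x = 1 := by
      ext i j
      obtain rfl := Subsingleton.elim i j
      simpa [Matrix.mul_apply, dotProduct] using hx
    have hPc : Pᵀ * replicateCol (Fin 1) x = 0 := by
      ext i j
      simpa [Matrix.mul_apply, mulVec, dotProduct] using congrFun hPx i
    have hcP : (replicateCol (Fin 1) x)ᵀ * P = 0 := by
      have := congrArg Matrix.transpose hPc
      simpa only [transpose_mul, transpose_transpose, transpose_zero] using this
    obtain ⟨P', h1, h2, h3⟩ := ih (a ⊕ Fin 1) (fromCols P (replicateCol (Fin 1) x)) (by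
      rw [transpose_fromCols, fromRows_mul_fromCols, h, hcol, hPc, hcP, fromBlocks_one])
      (by simp; omega)
    rw [transpose_fromCols, fromRows_mul] at h2
    have h4 : Pᵀ * P' = 0 := by
      ext i j; exact congrFun (congrFun h2 (Sum.inl i)) j
    have h5 : (replicateCol (Fin 1) x)ᵀ * P' = 0 := by
      ext i j; exact congrFun (congrFun h2 (Sum.inr i)) j
    have h6 : P'ᵀ * replicateCol (Fin 1) x = 0 := by
      have := congrArg Matrix.transpose h5
      simpa only [transpose_mul, transpose_transpose, transpose_zero] using this
    rw [transpose_fromCols, fromCols_mul_fromRows] at h3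
    have he : k + 1 = 1 + k := by omega
    let e : Fin (k + 1) ≃ Fin 1 ⊕ Fin k := (finCongr he).trans finSumFinEquiv.symm
    refine ⟨(fromCols (replicateCol (Fin 1) x) P').submatrix id e, ?_, ?_, ?_⟩
    · rw [transpose_submatrix, ← submatrix_mul _ _ _ _ _ Function.bijective_id, transpose_fromCols,
        fromRows_mul_fromCols, hcol, h1, h5, h6, fromBlocks_one, submatrix_one_equiv]
    · rw [show Pᵀ = Pᵀ.submatrix id id by rfl, ← submatrix_mul _ _ _ _ _ Function.bijective_id,
        mul_fromCols, hPc, h4]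
      ext i j
      simp only [submatrix_apply]
      rcases e j with j | j <;> simp
    · rw [transpose_submatrix, ← submatrix_mul _ _ _ _ _ e.bijective, transpose_fromCols,
        fromCols_mul_fromRows, ← h3]
      simp [add_assoc]

/-- A nondegenerate pair of frames intertwining `R` and `B` splits off `B` as an orthogonal direct
summand of `R`. -/
theorem exists_orthEquiv_fromBlocks {P : Matrix m a ℂ} {Q : Matrix n b ℂ} {R : Matrix m n ℂ}
    {B : Matrix a b ℂ} (h : R * Q = P * B) (h' : Rᵀ * P = Q * Bᵀ) (hP : IsUnit (Pᵀ * P).det)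
    (hQ : IsUnit (Qᵀ * Q).det) :
    ∃ (k l : ℕ) (R' : Matrix (Fin k) (Fin l) ℂ), Fintype.card m = Fintype.card a + k ∧
      Fintype.card n = Fintype.card b + l ∧ OrthEquiv R (fromBlocks B 0 0 R') := by
  obtain ⟨P₁, Q₁, h1, h2, h3, h4⟩ := exists_normalize h h' hP hQ
  have card_le : ∀ {m a : Type} [Fintype m] [Fintype a] [DecidableEq m] [DecidableEq a]
      {P : Matrix m a ℂ}, Pᵀ * P = 1 → Fintype.card a ≤ Fintype.card m := by
    intro m a _ _ _ _ P hP
    have := rank_mul_le_right Pᵀ P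
    rw [hP, rank_one] at this
    exact this.trans P.rank_le_card_height
  obtain ⟨k, hk⟩ := Nat.exists_eq_add_of_le (card_le h1)
  obtain ⟨l, hl⟩ := Nat.exists_eq_add_of_le (card_le h2)
  obtain ⟨P', p1, p2, p3⟩ := exists_orthogonal_completion k a P₁ h1 hk
  obtain ⟨Q', q1, q2, q3⟩ := exists_orthogonal_completion l b Q₁ h2 hl
  have p4 : P'ᵀ * P₁ = 0 := by
    have := congrArg Matrix.transpose p2
    simpa only [transpose_mul, transpose_transpose, transpose_zero] using this
  have q4 : Q'ᵀ * Q₁ = 0 := by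
    have := congrArg Matrix.transpose q2
    simpa only [transpose_mul, transpose_transpose, transpose_zero] using this
  have h5 : P₁ᵀ * R = B * Q₁ᵀ := by
    have := congrArg Matrix.transpose h4
    simpa only [transpose_mul, transpose_transpose] using this
  refine ⟨k, l, P'ᵀ * R * Q', hk, hl, (fromCols P₁ P')ᵀ, (fromCols Q₁ Q')ᵀ, ?_, ?_, ?_, ?_, ?_⟩
  · rw [transpose_transpose, transpose_fromCols, fromCols_mul_fromRows, p3]
  · rw [transpose_transpose, transpose_fromCols, fromRows_mul_fromCols, h1, p1, p2, p4,
      fromBlocks_one]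
  · rw [transpose_transpose, transpose_fromCols, fromCols_mul_fromRows, q3]
  · rw [transpose_transpose, transpose_fromCols, fromRows_mul_fromCols, h2, q1, q2, q4,
      fromBlocks_one]
  · rw [transpose_fromCols, transpose_fromCols, fromRows_mul, fromBlocks_mul_fromRows, h5]
    congr 1
    · simp
    -- The off-diagonal part vanishes since `R` maps the frame `Q₁` into the span of `P₁`, which is
    -- orthogonal to `P'`.
    · have h6 : P'ᵀ * R * (Q₁ * Q₁ᵀ) = 0 := by
        rw [← Matrix.mul_assoc, Matrix.mul_assoc P'ᵀ, h3, ← Matrix.mul_assoc, p4]; simp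
      have h7 := congrArg (P'ᵀ * R * ·) q3
      simp only [Matrix.mul_add, h6, Matrix.mul_one, zero_add] at h7
      rw [Matrix.zero_mul, zero_add, Matrix.mul_assoc _ Q', h7]

/-- Splitting off a summand that is only known up to isomorphism of pairs. -/
theorem exists_orthEquiv_fromBlocks_of_pairEquiv {P : Matrix m a ℂ} {Q : Matrix n b ℂ}
    {R : Matrix m n ℂ} {F : Matrix a b ℂ} {G : Matrix b a ℂ} {B : Matrix c d ℂ}
    (hB : PairEquiv F G B Bᵀ)
    (h : R * Q = P * F) (h' : Rᵀ * P = Q * G) (hP : IsUnit (Pᵀ * P).det)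
    (hQ : IsUnit (Qᵀ * Q).det) :
    ∃ (k l : ℕ) (R' : Matrix (Fin k) (Fin l) ℂ), Fintype.card m = Fintype.card c + k ∧
      Fintype.card n = Fintype.card d + l ∧ OrthEquiv R (fromBlocks B 0 0 R') := by
  obtain ⟨S, S', T, T', h1, h2, h3, h4, h5, h6⟩ := hB.symm
  have key : ∀ {m a c : Type} [Fintype m] [Fintype a] [Fintype c] [DecidableEq m] [DecidableEq a]
      [DecidableEq c] {P : Matrix m a ℂ} {S : Matrix a c ℂ} {S' : Matrix c a ℂ},
      IsUnit (Pᵀ * P).det → S' * S = 1 → S * S' = 1 → IsUnit ((P * S)ᵀ * (P * S)).det := by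
    intro m a c _ _ _ _ _ _ P S S' hP h1 h2
    refine (Matrix.isUnit_iff_isUnit_det _).1
      (IsUnit.of_mul_eq_one (S' * (Pᵀ * P)⁻¹ * S'ᵀ) ?_)
    rw [transpose_mul]
    calc Sᵀ * Pᵀ * (P * S) * (S' * (Pᵀ * P)⁻¹ * S'ᵀ)
        = Sᵀ * ((Pᵀ * P) * (S * S') * (Pᵀ * P)⁻¹) * S'ᵀ := by simp only [Matrix.mul_assoc]
      _ = (S' * S)ᵀ := by
        rw [h2, Matrix.mul_one, mul_nonsing_inv _ hP, Matrix.mul_one, transpose_mul]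
      _ = 1 := by rw [h1, transpose_one]
  refine exists_orthEquiv_fromBlocks (P := P * S) (Q := Q * T) ?_ ?_ (key hP h1 h2) (key hQ h3 h4)
  · rw [← Matrix.mul_assoc, h, Matrix.mul_assoc, ← h5, Matrix.mul_assoc]
  · rw [← Matrix.mul_assoc, h', Matrix.mul_assoc, ← h6, Matrix.mul_assoc]

/-- Reversing the columns makes the matrix upper triangular. This is the shape of the Gram matrices
of chains: they depend, at least up to parity, on `i + j` only and vanish from `i + j = k` on. -/
theorem isUnit_det_of_antitriangular {k : ℕ} (A : Matrix (Fin k) (Fin k) ℂ)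
    (h0 : ∀ i j : Fin k, k ≤ (i : ℕ) + j → A i j = 0)
    (h1 : ∀ i j : Fin k, (i : ℕ) + j + 1 = k → A i j ≠ 0) : IsUnit A.det := by
  have ht : (A.submatrix id Fin.revPerm).BlockTriangular id := by
    intro i j hij
    refine h0 _ _ ?_
    have : (j : ℕ) < i := hij
    simp [Fin.val_rev]
    omega
  have hd : (A.submatrix id Fin.revPerm).det ≠ 0 := by
    rw [det_of_isUpperTriangular ht, Finset.prod_ne_zero_iff]
    intro i _
    refine h1 _ _ ?_
    simp [Fin.val_rev]
    omega
  rw [det_permute'] at hd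
  exact isUnit_iff_ne_zero.2 (right_ne_zero_of_mul hd)

end Splitting

/-! ### Shift models of the blocks -/

section Models

/-- The partial shift that moves the `j`-th basis vector to the `(j + s)`-th one, or to `0`. -/
def shiftMatrix (a b s : ℕ) : Matrix (Fin a) (Fin b) ℂ :=
  Matrix.of fun i j => if (i : ℕ) = j + s then 1 else 0

theorem shiftMatrix_mul_apply {ι : Type} (a b s : ℕ) (X : Matrix (Fin b) ι ℂ) (i : Fin a) (j : ι) :
    (shiftMatrix a b s * X) i j =
      if h : s ≤ i ∧ (i : ℕ) - s < b then X ⟨i - s, h.2⟩ j else 0 := by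
  rw [Matrix.mul_apply]
  split_ifs with h
  · rw [Finset.sum_eq_single ⟨i - s, h.2⟩]
    · simp [shiftMatrix, h.1]
    · intro x _ hx
      rw [shiftMatrix, of_apply, if_neg, zero_mul]
      intro hi
      exact hx (Fin.ext (by simp; omega))
    · simp
  · refine Finset.sum_eq_zero fun x _ => ?_
    rw [shiftMatrix, of_apply, if_neg, zero_mul]
    intro hi
    have := x.isLt
    exact h (by omega)

theorem mul_shiftMatrix_apply {ι : Type} (a b s : ℕ) (X : Matrix ι (Fin a) ℂ) (i : ι) (j : Fin b) :
    (X * shiftMatrix a b s) i j =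
      if h : (j : ℕ) + s < a then X i ⟨j + s, h⟩ else 0 := by
  rw [Matrix.mul_apply]
  split_ifs with h
  · rw [Finset.sum_eq_single ⟨j + s, h⟩]
    · simp [shiftMatrix]
    · intro x _ hx
      rw [shiftMatrix, of_apply, if_neg, mul_zero]
      intro hi
      exact hx (Fin.ext (by simp; omega))
    · simp
  · refine Finset.sum_eq_zero fun x _ => ?_
    rw [shiftMatrix, of_apply, if_neg, mul_zero]
    intro hi
    have := x.isLt
    omega

theorem shiftMatrix_mul (a b c s t : ℕ) (h : a ≤ b + s) :
    shiftMatrix a b s * shiftMatrix b c t = shiftMatrix a c (s + t) := by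
  ext i j
  have := i.isLt
  rw [shiftMatrix_mul_apply]
  simp only [shiftMatrix, of_apply]
  split_ifs <;> first | rfl | omega

theorem shiftMatrix_zero (a : ℕ) : shiftMatrix a a 0 = 1 := by
  ext i j
  simp [shiftMatrix, Matrix.one_apply, Fin.ext_iff]

theorem shiftMatrix_pow (a s k : ℕ) : shiftMatrix a a s ^ k = shiftMatrix a a (k * s) := by
  induction k with
  | zero => simp [shiftMatrix_zero]
  | succ k ih =>
    rw [pow_succ', ih, shiftMatrix_mul _ _ _ _ _ (by omega)]
    congr 1; ring

theorem rank_shiftMatrix (a b s : ℕ) : (shiftMatrix a b s).rank = min b (a - s) := by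
  apply le_antisymm
  · refine le_min (by simpa using (shiftMatrix a b s).rank_le_width) ?_
    have : shiftMatrix a b s = shiftMatrix a (a - s) s * shiftMatrix (a - s) b 0 := by
      rw [shiftMatrix_mul _ _ _ _ _ (by omega), add_zero]
    rw [this]
    exact (rank_mul_le_left _ _).trans (by simpa using (shiftMatrix a (a - s) s).rank_le_width)
  · obtain ⟨r, hr⟩ : ∃ r, r = min b (a - s) := ⟨_, rfl⟩
    rw [← hr]
    have key : (shiftMatrix a r s)ᵀ * (shiftMatrix a b s * shiftMatrix b r 0) = 1 := by
      ext i j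
      have hi := i.isLt
      have hj := j.isLt
      rw [Matrix.mul_apply, Finset.sum_eq_single ⟨i + s, by omega⟩]
      · rw [mul_shiftMatrix_apply]
        have hjb : (j : ℕ) + 0 < b := by omega
        simp [shiftMatrix, Matrix.one_apply, Fin.ext_iff]
        intro; omega
      · intro x _ hx
        rw [transpose_apply, shiftMatrix, of_apply, if_neg, zero_mul]
        intro hxi; exact hx (Fin.ext hxi)
      · simp
    have := congrArg Matrix.rank key
    rw [rank_one, Fintype.card_fin] at this
    exact this.symm.le.trans ((rank_mul_le_right _ _).trans (rank_mul_le_left _ _))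

/-- The entries of the nilpotent symmetric Jordan block, as a function of natural numbers. -/
noncomputable def symEntry (m p q : ℕ) : ℂ :=
  (if p + 1 = q ∨ q + 1 = p then (1 / 2 : ℂ) else 0)
      + (if p + q = m then Complex.I / 2 else 0)
      - (if p + q + 2 = m then Complex.I / 2 else 0)

theorem symEntry_comm (m p q : ℕ) : symEntry m p q = symEntry m q p := by
  simp only [symEntry, or_comm, add_comm p q]

/-- The entrywise form of `S (1 - i E) = (1 - i E) N`, with `N` the lower shift. It is stated for
natural indices so that it applies to the submatrix `oddEven` as well. -/
theorem symEntry_sub {m p q : ℕ} (hp : p < m) (hq : q < m) :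
    symEntry m p q - Complex.I * symEntry m p (m - 1 - q) =
      (if p = q + 1 then 1 else 0) - Complex.I * (if p + q + 2 = m then 1 else 0) := by
  have h1 : (p + (m - 1 - q) = m) ↔ p = q + 1 := by omega
  have h2 : (p + (m - 1 - q) + 2 = m) ↔ p + 1 = q := by omega
  have h3 : (p + 1 = m - 1 - q ∨ m - 1 - q + 1 = p) ↔ (p + q + 2 = m ∨ p + q = m) := by omega
  simp only [symEntry, h1, h2, h3]
  have hI := Complex.I_mul_I
  split_ifs <;> first | omega | ring1 | linear_combination (-1 / 2 : ℂ) * hI |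
    linear_combination (1 / 2 : ℂ) * hI

/-- The matrix `1 - i E`, where `E` reverses the order of the coordinates. -/
noncomputable def revFrame (a : ℕ) : Matrix (Fin a) (Fin a) ℂ :=
  1 - Complex.I • (1 : Matrix (Fin a) (Fin a) ℂ).submatrix id Fin.rev

/-- The inverse of `revFrame a`. -/
noncomputable def revFrameInv (a : ℕ) : Matrix (Fin a) (Fin a) ℂ :=
  (1 / 2 : ℂ) • (1 + Complex.I • (1 : Matrix (Fin a) (Fin a) ℂ).submatrix id Fin.rev)

theorem rev_mul_rev (a : ℕ) : (1 : Matrix (Fin a) (Fin a) ℂ).submatrix id Fin.rev *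
    (1 : Matrix (Fin a) (Fin a) ℂ).submatrix id Fin.rev = 1 := by
  ext i j
  simp [Matrix.mul_apply, Matrix.one_apply]

theorem revFrameInv_mul (a : ℕ) : revFrameInv a * revFrame a = 1 := by
  simp only [revFrame, revFrameInv, Matrix.mul_sub, Matrix.smul_mul, Matrix.add_mul,
    Matrix.mul_smul, rev_mul_rev, Matrix.one_mul, Matrix.mul_one]
  rw [smul_comm Complex.I, ← smul_sub, smul_add, smul_smul, Complex.I_mul_I]
  module

theorem revFrame_mul_inv (a : ℕ) : revFrame a * revFrameInv a = 1 :=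
  mul_eq_one_comm.1 (revFrameInv_mul a)

theorem mul_revFrame_apply {ι : Type} {a : ℕ} (X : Matrix ι (Fin a) ℂ) (i : ι) (j : Fin a) :
    (X * revFrame a) i j = X i j - Complex.I * X i j.rev := by
  rw [revFrame, Matrix.mul_sub, Matrix.mul_smul, Matrix.mul_one, Matrix.sub_apply,
    Matrix.smul_apply]
  simp [Matrix.mul_apply, Matrix.one_apply]

theorem revFrame_mul_apply {ι : Type} {a : ℕ} (X : Matrix (Fin a) ι ℂ) (i : Fin a) (j : ι) :
    (revFrame a * X) i j = X i j - Complex.I * X i.rev j := by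
  rw [revFrame, Matrix.sub_mul, Matrix.smul_mul, Matrix.one_mul, Matrix.sub_apply,
    Matrix.smul_apply]
  simp [Matrix.mul_apply, Matrix.one_apply, ← Fin.rev_eq_iff]

theorem symNilpotent_apply (m : ℕ) (p q : Fin m) : symNilpotent m p q = symEntry m p q := rfl

theorem symNilpotent_mul_revFrame (m : ℕ) :
    symNilpotent m * revFrame m = revFrame m * shiftMatrix m m 1 := by
  ext p q
  have hp := p.isLt
  have hq := q.isLt
  rw [mul_revFrame_apply, revFrame_mul_apply, symNilpotent_apply, symNilpotent_apply, Fin.val_rev,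
    show m - (q + 1) = m - 1 - q by omega, symEntry_sub hp hq]
  simp only [shiftMatrix, of_apply, Fin.val_rev]
  congr 3
  simp; omega

theorem symNilpotent_transpose (m : ℕ) : (symNilpotent m)ᵀ = symNilpotent m := by
  ext p q
  exact symEntry_comm m q p

theorem symJordan_transpose (lam : ℂ) (m : ℕ) : (symJordan lam m)ᵀ = symJordan lam m := by
  simp [symJordan, symNilpotent_transpose]

theorem pairEquiv_symJordan (lam : ℂ) (m : ℕ) :
    PairEquiv (lam • 1 + shiftMatrix m m 1) (lam • 1 + shiftMatrix m m 1) (symJordan lam m)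
      (symJordan lam m)ᵀ := by
  have h : revFrame m * (lam • 1 + shiftMatrix m m 1) = symJordan lam m * revFrame m := by
    rw [symJordan, Matrix.mul_add, Matrix.add_mul, symNilpotent_mul_revFrame]; simp
  exact ⟨revFrame m, revFrameInv m, revFrame m, revFrameInv m, revFrameInv_mul m,
    revFrame_mul_inv m, revFrameInv_mul m, revFrame_mul_inv m, h, by rw [symJordan_transpose, h]⟩

theorem oddEven_apply (k : ℕ) (p : Fin (k + 1)) (q : Fin k) :
    oddEven k p q = symEntry (2 * k + 1) (2 * p) (2 * q + 1) := rfl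

/-- Reversing `2 * k + 1` coordinates preserves parity, so the frame `1 - i E` restricts to the
selected rows and to the selected columns. The model is one chain alternating between the two
spaces, starting and ending among the `k + 1` row vectors. -/
theorem pairEquiv_oddEven (k : ℕ) :
    PairEquiv (shiftMatrix (k + 1) k 1) (shiftMatrix k (k + 1) 0) (oddEven k) (oddEven k)ᵀ := by
  refine ⟨revFrame _, revFrameInv _, revFrame _, revFrameInv _, revFrameInv_mul _,
    revFrame_mul_inv _, revFrameInv_mul _, revFrame_mul_inv _, ?_, ?_⟩
  · ext p q
    have hp := p.isLt
    have hq := q.isLt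
    rw [mul_revFrame_apply, revFrame_mul_apply, oddEven_apply, oddEven_apply, Fin.val_rev,
      show 2 * (k - (q + 1)) + 1 = 2 * k + 1 - 1 - (2 * q + 1) by omega,
      symEntry_sub (by omega) (by omega)]
    have e1 : 2 * (p : ℕ) = 2 * q + 1 + 1 ↔ (p : ℕ) = q + 1 := by omega
    have e2 : 2 * (p : ℕ) + (2 * q + 1) + 2 = 2 * k + 1 ↔ k + 1 - ((p : ℕ) + 1) = q + 1 := by omega
    simp only [shiftMatrix, of_apply, Fin.val_rev, e1, e2]
  · ext q p
    have hp := p.isLt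
    have hq := q.isLt
    rw [mul_revFrame_apply, revFrame_mul_apply, transpose_apply, transpose_apply, oddEven_apply,
      oddEven_apply, Fin.val_rev, symEntry_comm, symEntry_comm _ (2 * _),
      show 2 * (k + 1 - (p + 1)) = 2 * k + 1 - 1 - (2 * p) by omega,
      symEntry_sub (by omega) (by omega)]
    have e1 : 2 * (q : ℕ) + 1 = 2 * p + 1 ↔ (q : ℕ) = p + 0 := by omega
    have e2 : 2 * (q : ℕ) + 1 + 2 * p + 2 = 2 * k + 1 ↔ k - ((q : ℕ) + 1) = p + 0 := by omega
    simp only [shiftMatrix, of_apply, Fin.val_rev, e1, e2]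

end Models

/-! ### Rank invariants of a pair -/

section Ranks

variable {m n m' n' a b c d : Type}
  [Fintype m] [Fintype n] [Fintype m'] [Fintype n']
  [Fintype a] [Fintype b] [Fintype c] [Fintype d]
  [DecidableEq m] [DecidableEq n] [DecidableEq m'] [DecidableEq n']
  [DecidableEq a] [DecidableEq b] [DecidableEq c] [DecidableEq d]

omit [DecidableEq n] [DecidableEq m'] in
theorem rank_eq_of_mul_eq_mul {Z : Matrix m n ℂ} {Z' : Matrix m' n' ℂ} {P : Matrix m' m ℂ}
    {P' : Matrix m m' ℂ} {Q : Matrix n' n ℂ} {Q' : Matrix n n' ℂ} (h1 : P' * P = 1)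
    (h4 : Q * Q' = 1) (h : P * Z = Z' * Q) : Z'.rank ≤ Z.rank ∧ (Z.rank ≤ Z'.rank) := by
  constructor
  · have : Z' = P * Z * Q' := by rw [h, Matrix.mul_assoc, h4, Matrix.mul_one]
    rw [this]
    exact (rank_mul_le_left _ _).trans (rank_mul_le_right _ _)
  · have : Z = P' * (Z' * Q) := by rw [← h, ← Matrix.mul_assoc, h1, Matrix.one_mul]
    rw [this]
    exact (rank_mul_le_right _ _).trans (rank_mul_le_left _ _)

omit [Fintype m] [Fintype a] [DecidableEq m] [DecidableEq n] [DecidableEq a] [DecidableEq b] in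
theorem rank_fromBlocks_diagonal (A : Matrix m n ℂ) (B : Matrix a b ℂ) :
    (fromBlocks A 0 0 B).rank = A.rank + B.rank := by
  have h : (fromBlocks A 0 0 B).mulVecLin =
      (LinearEquiv.sumArrowLequivProdArrow m a ℂ ℂ).symm.toLinearMap ∘ₗ
        (A.mulVecLin.prodMap B.mulVecLin) ∘ₗ
        (LinearEquiv.sumArrowLequivProdArrow n b ℂ ℂ).toLinearMap := by
    apply LinearMap.ext
    intro v
    ext (i | i) <;> simp [fromBlocks_mulVec] <;> rfl
  rw [Matrix.rank, h, LinearMap.range_comp, LinearEquiv.finrank_map_eq, LinearMap.range_comp,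
    LinearEquiv.range, Submodule.map_top, LinearMap.range_prodMap, Matrix.rank, Matrix.rank,
    ← Module.finrank_prod]
  exact LinearEquiv.finrank_eq
    { toFun := fun x => (⟨x.1.1, x.2.1⟩, ⟨x.1.2, x.2.2⟩)
      invFun := fun x => ⟨(x.1.1, x.2.1), x.1.2, x.2.2⟩
      map_add' := fun _ _ => rfl
      map_smul' := fun _ _ => rfl
      left_inv := fun _ => rfl
      right_inv := fun _ => rfl }

/-- The rank of `(F G - mu)ʲ`. -/
noncomputable def eigenRank (F : Matrix m n ℂ) (G : Matrix n m ℂ) (mu : ℂ) (j : ℕ) : ℕ :=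
  ((F * G - mu • (1 : Matrix m m ℂ)) ^ j).rank

/-- The rank of `(F G)ʲ F`. -/
noncomputable def oddRank (F : Matrix m n ℂ) (G : Matrix n m ℂ) (j : ℕ) : ℕ :=
  ((F * G) ^ j * F).rank

theorem pow_intertwine {S : Matrix m m ℂ} {T : Matrix a a ℂ} {P : Matrix m a ℂ}
    (h : S * P = P * T) (k : ℕ) : S ^ k * P = P * T ^ k := by
  simpa using aeval_mul_eq_mul_aeval h (X ^ k)

omit [DecidableEq n] [DecidableEq n'] in
theorem PairEquiv.mul_intertwine {F : Matrix m n ℂ} {G : Matrix n m ℂ} {F' : Matrix m' n' ℂ}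
    {G' : Matrix n' m' ℂ} {P : Matrix m' m ℂ} {Q : Matrix n' n ℂ} (h5 : P * F = F' * Q)
    (h6 : Q * G = G' * P) (mu : ℂ) :
    (F' * G' - mu • (1 : Matrix m' m' ℂ)) * P = P * (F * G - mu • (1 : Matrix m m ℂ)) := by
  rw [Matrix.sub_mul, Matrix.mul_sub, ← Matrix.mul_assoc P, h5, Matrix.mul_assoc F' Q, h6]
  simp [Matrix.mul_assoc]

theorem PairEquiv.eigenRank_eq {F : Matrix m n ℂ} {G : Matrix n m ℂ} {F' : Matrix m' n' ℂ}
    {G' : Matrix n' m' ℂ} (h : PairEquiv F G F' G') (mu : ℂ) (j : ℕ) :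
    eigenRank F G mu j = eigenRank F' G' mu j := by
  obtain ⟨P, P', Q, Q', h1, h2, h3, h4, h5, h6⟩ := h
  have := rank_eq_of_mul_eq_mul h1 h2 (pow_intertwine (PairEquiv.mul_intertwine h5 h6 mu) j).symm
  exact le_antisymm this.2 this.1

theorem PairEquiv.oddRank_eq {F : Matrix m n ℂ} {G : Matrix n m ℂ} {F' : Matrix m' n' ℂ}
    {G' : Matrix n' m' ℂ} (h : PairEquiv F G F' G') (j : ℕ) :
    oddRank F G j = oddRank F' G' j := by
  obtain ⟨P, P', Q, Q', h1, h2, h3, h4, h5, h6⟩ := h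
  have h7 : (F' * G') ^ j * P = P * (F * G) ^ j := by
    simpa using pow_intertwine (PairEquiv.mul_intertwine h5 h6 0) j
  have := rank_eq_of_mul_eq_mul (Z := (F * G) ^ j * F) (Z' := (F' * G') ^ j * F') h1 h4 (by
    rw [← Matrix.mul_assoc, ← h7, Matrix.mul_assoc, h5, Matrix.mul_assoc])
  exact le_antisymm this.2 this.1

omit [DecidableEq n] [DecidableEq b] in
theorem eigenRank_fromBlocks (F : Matrix m n ℂ) (G : Matrix n m ℂ) (F' : Matrix a b ℂ)
    (G' : Matrix b a ℂ) (mu : ℂ) (j : ℕ) :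
    eigenRank (fromBlocks F 0 0 F') (fromBlocks G 0 0 G') mu j =
      eigenRank F G mu j + eigenRank F' G' mu j := by
  rw [eigenRank, fromBlocks_multiply, ← fromBlocks_one, fromBlocks_smul, sub_eq_add_neg,
    fromBlocks_neg, fromBlocks_add]
  simp [← sub_eq_add_neg, fromBlocks_diagonal_pow, rank_fromBlocks_diagonal, eigenRank]

omit [DecidableEq n] [DecidableEq b] in
theorem oddRank_fromBlocks (F : Matrix m n ℂ) (G : Matrix n m ℂ) (F' : Matrix a b ℂ)
    (G' : Matrix b a ℂ) (j : ℕ) :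
    oddRank (fromBlocks F 0 0 F') (fromBlocks G 0 0 G') j = oddRank F G j + oddRank F' G' j := by
  rw [oddRank, fromBlocks_multiply]
  simp [fromBlocks_diagonal_pow, fromBlocks_multiply, rank_fromBlocks_diagonal, oddRank]

theorem oddRank_swap_transpose (R : Matrix m n ℂ) (j : ℕ) : oddRank Rᵀ R j = oddRank R Rᵀ j := by
  rw [oddRank, oddRank, ← rank_transpose]
  have := pow_intertwine (S := R * Rᵀ) (T := Rᵀ * R) (P := R) (by simp [Matrix.mul_assoc]) j
  simp [transpose_mul, transpose_pow, this]

end Ranks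

/-! ### Ranks of the model blocks -/

section ModelRanks

theorem isNilpotent_shiftMatrix (a s : ℕ) (hs : 0 < s) : IsNilpotent (shiftMatrix a a s) := by
  refine ⟨a, ?_⟩
  rw [shiftMatrix_pow]
  ext i j
  have := i.isLt
  rw [shiftMatrix, of_apply, if_neg, Matrix.zero_apply]
  nlinarith

theorem isUnit_smul_one_add {a : ℕ} {c : ℂ} (hc : c ≠ 0) {N : Matrix (Fin a) (Fin a) ℂ}
    (hN : IsNilpotent N) : IsUnit (c • 1 + N) := by
  refine hN.isUnit_add_left_of_commute ?_ (by simp [Commute, SemiconjBy])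
  exact ⟨⟨c • 1, c⁻¹ • 1, by simp [smul_smul, hc], by simp [smul_smul, hc]⟩, rfl⟩

theorem rank_pow_of_isUnit {a : ℕ} {N : Matrix (Fin a) (Fin a) ℂ} (hN : IsUnit N) (j : ℕ) :
    (N ^ j).rank = a := by
  simpa using rank_of_isUnit _ (hN.pow j)

theorem eigenRank_of_isNilpotent {a b : ℕ} {F : Matrix (Fin a) (Fin b) ℂ}
    {G : Matrix (Fin b) (Fin a) ℂ} {mu : ℂ} (hmu : mu ≠ 0) (h : IsNilpotent (F * G)) (j : ℕ) :
    eigenRank F G mu j = a := by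
  rw [eigenRank, sub_eq_neg_add, ← neg_smul]
  exact rank_pow_of_isUnit (isUnit_smul_one_add (neg_ne_zero.2 hmu) h) j

theorem eigenRank_oddEven (k : ℕ) (mu : ℂ) (j : ℕ) :
    eigenRank (oddEven k) (oddEven k)ᵀ mu j = if mu = 0 then k + 1 - j else k + 1 := by
  rw [← (pairEquiv_oddEven k).eigenRank_eq]
  have h := shiftMatrix_mul (k + 1) k (k + 1) 1 0 le_rfl
  split_ifs with hmu
  · rw [eigenRank, h, hmu, zero_smul, sub_zero, shiftMatrix_pow, rank_shiftMatrix]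
    simp
  · refine eigenRank_of_isNilpotent hmu ?_ j
    rw [h]; exact isNilpotent_shiftMatrix _ _ one_pos

theorem eigenRank_oddEven_transpose (k : ℕ) (mu : ℂ) (j : ℕ) :
    eigenRank (oddEven k)ᵀ (oddEven k) mu j = if mu = 0 then k - j else k := by
  rw [← (pairEquiv_oddEven k).swap.eigenRank_eq]
  have h := shiftMatrix_mul k (k + 1) k 0 1 (by omega)
  split_ifs with hmu
  · rw [eigenRank, h, hmu, zero_smul, sub_zero, shiftMatrix_pow, rank_shiftMatrix]
    simp
  · refine eigenRank_of_isNilpotent hmu ?_ j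
    rw [h]; exact isNilpotent_shiftMatrix _ _ one_pos

theorem oddRank_oddEven (k : ℕ) (j : ℕ) : oddRank (oddEven k) (oddEven k)ᵀ j = k - j := by
  rw [← (pairEquiv_oddEven k).oddRank_eq, oddRank, shiftMatrix_mul _ _ _ _ _ le_rfl,
    shiftMatrix_pow, shiftMatrix_mul _ _ _ _ _ (by omega), rank_shiftMatrix]
  omega

/-- In the shift model, `(lam + N) ^ 2 - mu = (lam ^ 2 - mu) + N * (2 * lam + N)`. This is
invertible if `lam ^ 2 ≠ mu`, `N` times a commuting unit if `lam ^ 2 = mu ≠ 0`, and `N ^ 2` if both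
vanish. -/
theorem eigenRank_symJordan (lam : ℂ) (m : ℕ) (mu : ℂ) (j : ℕ) :
    eigenRank (symJordan lam m) (symJordan lam m)ᵀ mu j =
      if lam ^ 2 = mu then (if mu = 0 then m - 2 * j else m - j) else m := by
  rw [← (pairEquiv_symJordan lam m).eigenRank_eq, eigenRank]
  set N := shiftMatrix m m 1 with hN
  have hNn : IsNilpotent N := isNilpotent_shiftMatrix _ _ one_pos
  have hcomm : Commute N ((2 * lam) • 1 + N) := by
    simp [Commute, SemiconjBy, Matrix.mul_add, Matrix.add_mul]
  have h : (lam • 1 + N) * (lam • 1 + N) - mu • (1 : Matrix (Fin m) (Fin m) ℂ) =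
      (lam ^ 2 - mu) • 1 + N * ((2 * lam) • 1 + N) := by
    simp only [Matrix.add_mul, Matrix.mul_add, Matrix.smul_mul, Matrix.mul_smul, Matrix.one_mul,
      Matrix.mul_one]
    module
  rw [h]
  split_ifs with h1 h2
  · have hl : lam = 0 := by simpa [h2] using h1
    rw [h1, hl, hN]
    simp only [sub_self, zero_smul, mul_zero, zero_add]
    rw [shiftMatrix_mul _ _ _ _ _ (by omega), shiftMatrix_pow, rank_shiftMatrix]
    omega
  · have hl : lam ≠ 0 := by rintro rfl; exact h2 (by simpa using h1.symm)
    have hu : IsUnit ((2 * lam) • 1 + N) := isUnit_smul_one_add (by simpa using hl) hNn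
    rw [h1, sub_self, zero_smul, zero_add, hcomm.mul_pow,
      rank_mul_eq_left_of_isUnit_det _ _ ((isUnit_iff_isUnit_det _).1 (hu.pow j)), hN,
      shiftMatrix_pow, rank_shiftMatrix]
    omega
  · exact rank_pow_of_isUnit (isUnit_smul_one_add (sub_ne_zero.2 h1)
      (hcomm.isNilpotent_mul_right hNn)) j

theorem oddRank_symJordan (lam : ℂ) (m : ℕ) (j : ℕ) :
    oddRank (symJordan lam m) (symJordan lam m)ᵀ j =
      if lam = 0 then m - (2 * j + 1) else m := by
  rw [← (pairEquiv_symJordan lam m).oddRank_eq, oddRank]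
  have hNn : IsNilpotent (shiftMatrix m m 1) := isNilpotent_shiftMatrix _ _ one_pos
  split_ifs with hl
  · rw [hl, zero_smul, zero_add, shiftMatrix_mul _ _ _ _ _ (by omega), shiftMatrix_pow,
      shiftMatrix_mul _ _ _ _ _ (by omega), rank_shiftMatrix]
    omega
  · rw [← sq, ← pow_mul, ← pow_succ]
    exact rank_pow_of_isUnit (isUnit_smul_one_add hl hNn) _

end ModelRanks

/-! ### Sums of parts and their multiplicities -/

section PartSums

/-- The number of rows of a part. -/
def Part.rows : Part → ℕ
  | .jordan _ m => m
  | .tall k => k + 1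
  | .wide l => l

/-- The number of columns of a part. -/
def Part.cols : Part → ℕ
  | .jordan _ m => m
  | .tall k => k
  | .wide l => l + 1

/-- The matrix of a part. -/
noncomputable def Part.toMatrix : (p : Part) → Matrix (Fin p.rows) (Fin p.cols) ℂ
  -- Either square root would do, as `lam` and `-lam` give orthogonally equivalent blocks.
  | .jordan mu m => symJordan (mu ^ (2⁻¹ : ℂ)) m
  | .tall k => oddEven k
  | .wide l => (oddEven l)ᵀ

/-- The parts that occur as constituents of blocks. -/
def Part.IsValid : Part → Prop
  | .jordan mu m => 1 ≤ m ∧ ¬(mu = 0 ∧ Odd m)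
  | .tall _ => True
  | .wide _ => True

/-- The number of rows of a direct sum of parts. -/
def sumRows : List Part → ℕ
  | [] => 0
  | p :: L => p.rows + sumRows L

/-- The number of columns of a direct sum of parts. -/
def sumCols : List Part → ℕ
  | [] => 0
  | p :: L => p.cols + sumCols L

/-- The direct sum of a list of parts. -/
noncomputable def partSum : (L : List Part) → Matrix (Fin (sumRows L)) (Fin (sumCols L)) ℂ
  | [] => 0
  | p :: L => (fromBlocks p.toMatrix 0 0 (partSum L)).reindex finSumFinEquiv finSumFinEquiv

theorem partSum_cons (p : Part) (L : List Part) :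
    OrthEquiv (fromBlocks p.toMatrix 0 0 (partSum L)) (partSum (p :: L)) :=
  OrthEquiv.reindex _ _ _

theorem OrthEquiv.partSum_of_perm {L L' : List Part} (h : L.Perm L') :
    OrthEquiv (partSum L) (partSum L') := by
  induction h with
  | nil => exact .refl _
  | cons p _ ih => exact (partSum_cons p _).symm.trans (((OrthEquiv.refl _).fromBlocks ih).trans
      (partSum_cons p _))
  | swap p q L =>
    have key : ∀ p q : Part, OrthEquiv (partSum (p :: q :: L))
        (Matrix.fromBlocks (Matrix.fromBlocks p.toMatrix 0 0 q.toMatrix) 0 0 (partSum L)) :=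
      fun p q => ((partSum_cons p _).symm.trans ((OrthEquiv.refl _).fromBlocks
        (partSum_cons q L).symm)).trans (OrthEquiv.fromBlocks_assoc _ _ _).symm
    exact (key q p).trans (((OrthEquiv.fromBlocks_comm _ _).fromBlocks (.refl _)).trans
      (key p q).symm)
  | trans _ _ ih ih' => exact ih.trans ih'

theorem partSum_append (L L' : List Part) :
    OrthEquiv (fromBlocks (partSum L) 0 0 (partSum L')) (partSum (L ++ L')) := by
  induction L with
  | nil =>
    let e : Fin (sumRows []) ⊕ Fin (sumRows L') ≃ Fin (sumRows L') :=
      Equiv.emptySum (Fin 0) (Fin (sumRows L'))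
    let f : Fin (sumCols []) ⊕ Fin (sumCols L') ≃ Fin (sumCols L') :=
      Equiv.emptySum (Fin 0) (Fin (sumCols L'))
    have h := OrthEquiv.reindex (Matrix.fromBlocks (partSum []) 0 0 (partSum L')) e f
    rwa [show Matrix.reindex e f (Matrix.fromBlocks (partSum []) 0 0 (partSum L')) =
      partSum L' by ext i j; rfl] at h
  | cons p L ih =>
    exact (((partSum_cons p L).symm.fromBlocks (.refl _)).trans
      (OrthEquiv.fromBlocks_assoc _ _ _)).trans
      (((OrthEquiv.refl _).fromBlocks ih).trans (partSum_cons p (L ++ L')))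

theorem eigenRank_partSum_cons (p : Part) (L : List Part) (mu : ℂ) (j : ℕ) :
    eigenRank (partSum (p :: L)) (partSum (p :: L))ᵀ mu j =
      eigenRank p.toMatrix p.toMatrixᵀ mu j + eigenRank (partSum L) (partSum L)ᵀ mu j := by
  rw [← (partSum_cons p L).pairEquiv.eigenRank_eq, fromBlocks_transpose, transpose_zero,
    transpose_zero, eigenRank_fromBlocks]

theorem eigenRank_partSum_cons_transpose (p : Part) (L : List Part) (mu : ℂ) (j : ℕ) :
    eigenRank (partSum (p :: L))ᵀ (partSum (p :: L)) mu j =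
      eigenRank p.toMatrixᵀ p.toMatrix mu j + eigenRank (partSum L)ᵀ (partSum L) mu j := by
  rw [← (partSum_cons p L).pairEquiv.swap.eigenRank_eq, fromBlocks_transpose, transpose_zero,
    transpose_zero, eigenRank_fromBlocks]

theorem oddRank_partSum_cons (p : Part) (L : List Part) (j : ℕ) :
    oddRank (partSum (p :: L)) (partSum (p :: L))ᵀ j =
      oddRank p.toMatrix p.toMatrixᵀ j + oddRank (partSum L) (partSum L)ᵀ j := by
  rw [← (partSum_cons p L).pairEquiv.oddRank_eq, fromBlocks_transpose, transpose_zero,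
    transpose_zero, oddRank_fromBlocks]

/-- The number of times that a valid part occurs in a matrix, computed from ranks. -/
noncomputable def multiplicity {m n : Type} [Fintype m] [Fintype n] [DecidableEq m]
    [DecidableEq n] (R : Matrix m n ℂ) : Part → ℤ
  -- For `mu ≠ 0` this is the usual second difference counting Jordan blocks of size `k`. For
  -- nilpotent parts it is inclusion–exclusion over alternating chains: the rank of a word counts
  -- the pairs of chain vectors that it joins, and subtracting the pairs extendable to the left or
  -- to the right, and adding back those extendable both ways, leaves the maximal chains with given
  -- end types. Words of odd length in the two directions are transposes of each other, hence the
  -- factors `2` in the last two cases.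
  | .jordan mu k =>
    if mu = 0 then oddRank R Rᵀ (k / 2 - 1) - eigenRank R Rᵀ 0 (k / 2)
      - eigenRank Rᵀ R 0 (k / 2) + oddRank R Rᵀ (k / 2)
    else eigenRank R Rᵀ mu (k - 1) - 2 * eigenRank R Rᵀ mu k + eigenRank R Rᵀ mu (k + 1)
  | .tall k => eigenRank R Rᵀ 0 k - 2 * oddRank R Rᵀ k + eigenRank Rᵀ R 0 (k + 1)
  | .wide k => eigenRank Rᵀ R 0 k - 2 * oddRank R Rᵀ k + eigenRank R Rᵀ 0 (k + 1)

theorem OrthEquiv.multiplicity_eq {m n m' n' : Type} [Fintype m] [Fintype n] [DecidableEq m]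
    [DecidableEq n] [Fintype m'] [Fintype n'] [DecidableEq m'] [DecidableEq n']
    {R : Matrix m n ℂ} {R' : Matrix m' n' ℂ} (h : OrthEquiv R R') (p : Part) :
    multiplicity R p = multiplicity R' p := by
  have h1 := h.pairEquiv.eigenRank_eq
  have h2 := h.pairEquiv.swap.eigenRank_eq
  have h3 := h.pairEquiv.oddRank_eq
  cases p <;> simp only [multiplicity, h1, h2, h3]

theorem multiplicity_partSum_cons (q : Part) (L : List Part) (p : Part) :
    multiplicity (partSum (q :: L)) p = multiplicity q.toMatrix p + multiplicity (partSum L) p := by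
  cases p <;> simp only [multiplicity, eigenRank_partSum_cons, eigenRank_partSum_cons_transpose,
    oddRank_partSum_cons] <;> push_cast
  · split_ifs <;> ring
  · ring
  · ring

theorem multiplicity_partSum_nil (p : Part) : multiplicity (partSum []) p = 0 := by
  have h1 : ∀ mu j, eigenRank (partSum []) (partSum [])ᵀ mu j = 0 := fun mu j =>
    Nat.le_zero.1 (rank_le_height (m := 0) _)
  have h2 : ∀ mu j, eigenRank (partSum [])ᵀ (partSum []) mu j = 0 := fun mu j =>
    Nat.le_zero.1 (rank_le_height (m := 0) _)
  have h3 : ∀ j, oddRank (partSum []) (partSum [])ᵀ j = 0 := fun j =>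
    Nat.le_zero.1 (rank_le_height (m := 0) _)
  cases p <;> simp [multiplicity, h1, h2, h3]

-- Validity is essential: an odd nilpotent Jordan block has the same ranks as its tall and wide
-- halves together. It also makes `k - 1` and `k / 2 - 1` honest subtractions.
open Classical in
theorem multiplicity_part {p q : Part} (hp : p.IsValid) (hq : q.IsValid) :
    multiplicity q.toMatrix p = if q = p then 1 else 0 := by
  have hs : ∀ mu : ℂ, (mu ^ (2⁻¹ : ℂ)) ^ 2 = mu := fun mu => by simp
  have hz : ∀ mu : ℂ, mu ^ (2⁻¹ : ℂ) = 0 ↔ mu = 0 := fun mu => by simp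
  have t1 : ∀ mu m j, eigenRank (symJordan mu m)ᵀ (symJordan mu m) 0 j =
      eigenRank (symJordan mu m) (symJordan mu m)ᵀ 0 j := fun mu m j => by
    simp only [symJordan_transpose]
  have t2 : ∀ k j, oddRank (oddEven k)ᵀ (oddEven k) j = k - j := fun k j => by
    rw [oddRank_swap_transpose, oddRank_oddEven]
  cases q with
  | jordan nu l =>
    change multiplicity (symJordan (nu ^ (2⁻¹ : ℂ)) l) p = _
    obtain ⟨q1, q2⟩ := hq
    cases p with
    | jordan mu k =>
      obtain ⟨p1, p2⟩ := hp
      simp only [multiplicity, t1, eigenRank_symJordan, oddRank_symJordan, hs, hz,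
        Part.jordan.injEq]
      by_cases hmu : mu = 0
      · subst hmu
        simp only [true_and, Nat.not_odd_iff_even] at p2
        obtain ⟨t, rfl⟩ := p2
        by_cases hnu : nu = 0
        · subst hnu
          simp only [true_and, Nat.not_odd_iff_even] at q2
          obtain ⟨s, rfl⟩ := q2
          simp
          split_ifs <;> omega
        · simp [hnu]
      · by_cases hnu : nu = mu
        · subst hnu
          simp [hmu]
          split_ifs <;> omega
        · simp [hmu, hnu]
          ring
    | tall k =>
      simp only [multiplicity, t1, eigenRank_symJordan, oddRank_symJordan, hs, hz]
      by_cases hnu : nu = 0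
      · subst hnu
        simp only [true_and, Nat.not_odd_iff_even] at q2
        obtain ⟨s, rfl⟩ := q2
        simp
        omega
      · simp [hnu]
        ring
    | wide k =>
      simp only [multiplicity, t1, eigenRank_symJordan, oddRank_symJordan, hs, hz]
      by_cases hnu : nu = 0
      · subst hnu
        simp only [true_and, Nat.not_odd_iff_even] at q2
        obtain ⟨s, rfl⟩ := q2
        simp
        omega
      · simp [hnu]
        ring
  | tall l =>
    change multiplicity (oddEven l) p = _
    cases p with
    | jordan mu k =>
      obtain ⟨p1, p2⟩ := hp
      simp only [multiplicity, eigenRank_oddEven, eigenRank_oddEven_transpose,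
        oddRank_oddEven, if_true]
      by_cases hmu : mu = 0
      · subst hmu
        simp only [true_and, Nat.not_odd_iff_even] at p2
        obtain ⟨t, rfl⟩ := p2
        simp
        omega
      · simp [hmu]
        ring
    | tall k =>
      simp only [multiplicity, eigenRank_oddEven, eigenRank_oddEven_transpose,
        oddRank_oddEven, if_true, Part.tall.injEq]
      split_ifs <;> omega
    | wide k =>
      simp only [multiplicity, eigenRank_oddEven, eigenRank_oddEven_transpose,
        oddRank_oddEven, if_true, reduceCtorEq, if_false]
      omega
  | wide l =>
    change multiplicity (oddEven l)ᵀ p = _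
    cases p with
    | jordan mu k =>
      obtain ⟨p1, p2⟩ := hp
      simp only [multiplicity, transpose_transpose, eigenRank_oddEven,
        eigenRank_oddEven_transpose, t2, if_true]
      by_cases hmu : mu = 0
      · subst hmu
        simp only [true_and, Nat.not_odd_iff_even] at p2
        obtain ⟨t, rfl⟩ := p2
        simp
        omega
      · simp [hmu]
        ring
    | tall k =>
      simp only [multiplicity, transpose_transpose, eigenRank_oddEven,
        eigenRank_oddEven_transpose, t2, if_true, reduceCtorEq, if_false]
      omega
    | wide k =>
      simp only [multiplicity, transpose_transpose, eigenRank_oddEven,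
        eigenRank_oddEven_transpose, t2, if_true, Part.wide.injEq]
      split_ifs <;> omega

open Classical in
theorem multiplicity_partSum {p : Part} (hp : p.IsValid) (L : List Part)
    (hL : ∀ q ∈ L, q.IsValid) : multiplicity (partSum L) p = L.count p := by
  induction L with
  | nil => simpa using multiplicity_partSum_nil p
  | cons q L ih =>
    rw [multiplicity_partSum_cons, multiplicity_part hp (hL q (by simp)),
      ih fun r hr => hL r (by simp [hr]), List.count_cons]
    simp only [beq_iff_eq]
    split_ifs <;> push_cast <;> ring

theorem OrthEquiv.perm_of_partSum {L L' : List Part} (hL : ∀ q ∈ L, q.IsValid)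
    (hL' : ∀ q ∈ L', q.IsValid) (h : OrthEquiv (partSum L) (partSum L')) : L.Perm L' := by
  classical
  rw [List.perm_iff_count]
  intro p
  by_cases hp : p.IsValid
  · have := h.multiplicity_eq p
    rw [multiplicity_partSum hp L hL, multiplicity_partSum hp L' hL'] at this
    exact_mod_cast this
  · rw [List.count_eq_zero_of_not_mem fun h => hp (hL p h),
      List.count_eq_zero_of_not_mem fun h => hp (hL' p h)]

end PartSums

/-! ### Chains with invertible Gram matrix, and existence -/

section Chains

variable {m n : Type} [Fintype m] [Fintype n] [DecidableEq m] [DecidableEq n]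

/-- The matrix whose columns are the first `k` vectors of a sequence. -/
def colMatrix {m : Type} (v : ℕ → m → ℂ) (k : ℕ) : Matrix m (Fin k) ℂ :=
  Matrix.of fun i j => v j i

omit [Fintype m] [DecidableEq m] [DecidableEq n] in
theorem mul_colMatrix (A : Matrix m n ℂ) (v : ℕ → n → ℂ) (k : ℕ) :
    A * colMatrix v k = colMatrix (fun j => A *ᵥ v j) k := rfl

omit [Fintype m] [DecidableEq m] in
theorem colMatrix_mul_shiftMatrix (v : ℕ → m → ℂ) (a b s : ℕ)
    (h : ∀ j, a ≤ j → j < b + s → v j = 0) :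
    colMatrix v a * shiftMatrix a b s = colMatrix (fun j => v (j + s)) b := by
  ext i j
  have := j.isLt
  rw [mul_shiftMatrix_apply]
  split_ifs with hj
  · rfl
  · simp [colMatrix, h (j + s) (by omega) (by omega)]

omit [DecidableEq m] in
theorem colMatrix_transpose_mul_apply (v w : ℕ → m → ℂ) (k : ℕ) (i j : Fin k) :
    ((colMatrix v k)ᵀ * colMatrix w k) i j = v i ⬝ᵥ w j := rfl

omit [DecidableEq m] [DecidableEq n] in
theorem mulVec_dotProduct (A : Matrix m n ℂ) (u : n → ℂ) (v : m → ℂ) :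
    (A *ᵥ u) ⬝ᵥ v = u ⬝ᵥ (Aᵀ *ᵥ v) := by
  rw [dotProduct_comm, dotProduct_mulVec, dotProduct_comm, mulVec_transpose]

theorem pow_mulVec_dotProduct {Z : Matrix m m ℂ} (hZ : Zᵀ = Z) (x : m → ℂ) (i j : ℕ) :
    (Z ^ i *ᵥ x) ⬝ᵥ (Z ^ j *ᵥ x) = x ⬝ᵥ (Z ^ (i + j) *ᵥ x) := by
  rw [mulVec_dotProduct, transpose_pow, hZ, mulVec_mulVec, pow_add]

/-- The chain is `x, Rᵀ x, R Rᵀ x, …`. With `M = R * Rᵀ`, both Gram matrices have Hankel entries `x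
⬝ᵥ M ^ s *ᵥ x`, zero for `s > k` and nonzero for `s = k`. -/
theorem exists_split_tall (R : Matrix m n ℂ) (x : m → ℂ) (k : ℕ)
    (h0 : x ⬝ᵥ ((R * Rᵀ) ^ k *ᵥ x) ≠ 0) (h1 : Rᵀ * (R * Rᵀ) ^ k = 0) :
    ∃ (a b : ℕ) (R' : Matrix (Fin a) (Fin b) ℂ), Fintype.card m = k + 1 + a ∧
      Fintype.card n = k + b ∧ OrthEquiv R (fromBlocks (oddEven k) 0 0 R') := by
  set M := R * Rᵀ with hM
  have hMt : Mᵀ = M := by simp [hM]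
  have hM0 : ∀ j, k < j → M ^ j = 0 := by
    intro j hj
    obtain ⟨d, rfl⟩ := Nat.exists_eq_add_of_lt hj
    rw [show k + d + 1 = (k + 1) + d by ring, pow_add, pow_succ', hM, Matrix.mul_assoc R, h1]
    simp
  set v : ℕ → m → ℂ := fun j => M ^ j *ᵥ x with hv
  set w : ℕ → n → ℂ := fun j => Rᵀ *ᵥ v j with hw
  have hRw : ∀ j, R *ᵥ w j = v (j + 1) := fun j => by
    simp only [hw, hv, mulVec_mulVec, ← Matrix.mul_assoc, pow_succ', hM]
  have hvv : ∀ i j, v i ⬝ᵥ v j = x ⬝ᵥ (M ^ (i + j) *ᵥ x) := pow_mulVec_dotProduct hMt x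
  have hww : ∀ i j, w i ⬝ᵥ w j = x ⬝ᵥ (M ^ (i + j + 1) *ᵥ x) := fun i j => by
    rw [hw, mulVec_dotProduct, transpose_transpose, hRw, hvv, add_assoc]
  have hwk : w k = 0 := by simp only [hw, hv, mulVec_mulVec, h1, zero_mulVec]
  obtain ⟨a, b, R', e1, e2, e3⟩ := exists_orthEquiv_fromBlocks_of_pairEquiv
    (P := colMatrix v (k + 1)) (Q := colMatrix w k) (R := R) (pairEquiv_oddEven k) (by
      rw [mul_colMatrix, colMatrix_mul_shiftMatrix _ _ _ _ (by omega)]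
      simp only [hRw]) (by
      rw [mul_colMatrix, colMatrix_mul_shiftMatrix]
      · rfl
      · intro j h2 h3
        obtain rfl : j = k := by omega
        exact hwk) (by
      refine isUnit_det_of_antitriangular _ (fun i j hij => ?_) fun i j hij => ?_
      · rw [colMatrix_transpose_mul_apply, hvv, hM0 _ (by omega)]; simp
      · rw [colMatrix_transpose_mul_apply, hvv, show (i : ℕ) + j = k by omega]; exact h0) (by
      refine isUnit_det_of_antitriangular _ (fun i j hij => ?_) fun i j hij => ?_
      · rw [colMatrix_transpose_mul_apply, hww, hM0 _ (by omega)]; simp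
      · rw [colMatrix_transpose_mul_apply, hww, hij]; exact h0)
  exact ⟨a, b, R', by simpa using e1, by simpa using e2, e3⟩

/-- The two sequences obtained by applying `R` and its transpose alternately. -/
def alternating (R : Matrix m n ℂ) (x : m → ℂ) (y : n → ℂ) : ℕ → (m → ℂ) × (n → ℂ)
  | 0 => (x, y)
  | j + 1 => (R *ᵥ (alternating R x y j).2, Rᵀ *ᵥ (alternating R x y j).1)

theorem alternating_two_mul (R : Matrix m n ℂ) (x : m → ℂ) (y : n → ℂ) (j : ℕ) :
    alternating R x y (2 * j) = ((R * Rᵀ) ^ j *ᵥ x, (Rᵀ * R) ^ j *ᵥ y) := by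
  induction j with
  | zero => simp [alternating]
  | succ j ih =>
    rw [show 2 * (j + 1) = 2 * j + 1 + 1 by ring, alternating, alternating, ih]
    simp [pow_succ', Matrix.mul_assoc]

/-- Two chains are needed, one from `x` and one from `y`; interleaved, they make `R` and `Rᵀ` both
act as the shift. The hypothesis `h0` pairs each start with the end of the chain that begins at the
other. -/
theorem exists_split_jordan_zero (R : Matrix m n ℂ) (x : m → ℂ) (y : n → ℂ) (t : ℕ)
    (h0 : x ⬝ᵥ ((R * Rᵀ) ^ t * R) *ᵥ y ≠ 0) (h1 : (R * Rᵀ) ^ (t + 1) = 0)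
    (h2 : (Rᵀ * R) ^ (t + 1) = 0) :
    ∃ (a b : ℕ) (R' : Matrix (Fin a) (Fin b) ℂ), Fintype.card m = 2 * t + 2 + a ∧
      Fintype.card n = 2 * t + 2 + b ∧
      OrthEquiv R (fromBlocks (symJordan 0 (2 * t + 2)) 0 0 R') := by
  set v : ℕ → m → ℂ := fun j => (alternating R x y j).1 with hv
  set w : ℕ → n → ℂ := fun j => (alternating R x y j).2 with hw
  have hRw : ∀ j, R *ᵥ w j = v (j + 1) := fun j => rfl
  have hRv : ∀ j, Rᵀ *ᵥ v j = w (j + 1) := fun j => rfl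
  have hvw : ∀ i j, v (i + 1) ⬝ᵥ v j = w i ⬝ᵥ w (j + 1) := fun i j => by
    rw [← hRw, mulVec_dotProduct, hRv]
  have hwv : ∀ i j, w (i + 1) ⬝ᵥ w j = v i ⬝ᵥ v (j + 1) := fun i j => by
    rw [← hRv, mulVec_dotProduct, transpose_transpose, hRw]
  have hzero : ∀ j, 2 * t + 2 ≤ j → v j = 0 ∧ w j = 0 := by
    intro j hj
    induction j, hj using Nat.le_induction with
    | base =>
      have := alternating_two_mul R x y (t + 1)
      simp only [hv, hw, show 2 * t + 2 = 2 * (t + 1) by ring, this, h1, h2]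
      simp
    | succ j _ ih => rw [← hRw, ← hRv, ih.1, ih.2]; simp
  -- Moving one factor across the form switches between the two spaces, so the parity of `i` decides
  -- which alternative holds; both have the same zero pattern where it matters.
  have hgram : ∀ i j, (v i ⬝ᵥ v j = v 0 ⬝ᵥ v (i + j) ∨ v i ⬝ᵥ v j = w 0 ⬝ᵥ w (i + j)) ∧
      (w i ⬝ᵥ w j = v 0 ⬝ᵥ v (i + j) ∨ w i ⬝ᵥ w j = w 0 ⬝ᵥ w (i + j)) := by
    intro i
    induction i with
    | zero => intro j; simp
    | succ i ih =>
      intro j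
      rw [hvw, hwv, show i + 1 + j = i + (j + 1) by ring]
      exact ⟨(ih (j + 1)).2, (ih (j + 1)).1⟩
  have hv1 : v 0 ⬝ᵥ v (2 * t + 1) ≠ 0 := by
    have h3 : v (2 * t + 1) = ((R * Rᵀ) ^ t * R) *ᵥ y := by
      rw [← hRw, hw]
      simp only [alternating_two_mul, mulVec_mulVec]
      rw [pow_intertwine (S := R * Rᵀ) (T := Rᵀ * R) (P := R) (by simp [Matrix.mul_assoc]) t]
    rw [h3]; exact h0
  have hw1 : w 0 ⬝ᵥ w (2 * t + 1) ≠ 0 := by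
    have h3 : w (2 * t + 1) = ((R * Rᵀ) ^ t * R)ᵀ *ᵥ x := by
      rw [← hRv, hv]
      simp only [alternating_two_mul, mulVec_mulVec, transpose_mul, transpose_pow,
        transpose_transpose]
    rw [h3, ← mulVec_dotProduct, dotProduct_comm]; exact h0
  have key : ∀ k, 2 * t + 2 ≤ k → v 0 ⬝ᵥ v k = 0 ∧ w 0 ⬝ᵥ w k = 0 := fun k hk => by
    rw [(hzero k hk).1, (hzero k hk).2]; simp
  obtain ⟨a, b, R', e1, e2, e3⟩ := exists_orthEquiv_fromBlocks_of_pairEquiv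
    (P := colMatrix v (2 * t + 2)) (Q := colMatrix w (2 * t + 2)) (R := R)
    (pairEquiv_symJordan 0 (2 * t + 2)) (by
      rw [mul_colMatrix, zero_smul, zero_add,
        colMatrix_mul_shiftMatrix _ _ _ _ fun j hj _ => (hzero j hj).1]
      rfl) (by
      rw [mul_colMatrix, zero_smul, zero_add,
        colMatrix_mul_shiftMatrix _ _ _ _ fun j hj _ => (hzero j hj).2]
      rfl) (by
      refine isUnit_det_of_antitriangular _ (fun i j hij => ?_) fun i j hij => ?_
      · rw [colMatrix_transpose_mul_apply]
        rcases (hgram i j).1 with h | h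
        · rw [h, (key _ hij).1]
        · rw [h, (key _ hij).2]
      · rw [colMatrix_transpose_mul_apply]
        have : (i : ℕ) + j = 2 * t + 1 := by omega
        rcases (hgram i j).1 with h | h
        · rw [h, this]; exact hv1
        · rw [h, this]; exact hw1) (by
      refine isUnit_det_of_antitriangular _ (fun i j hij => ?_) fun i j hij => ?_
      · rw [colMatrix_transpose_mul_apply]
        rcases (hgram i j).2 with h | h
        · rw [h, (key _ hij).1]
        · rw [h, (key _ hij).2]
      · rw [colMatrix_transpose_mul_apply]
        have : (i : ℕ) + j = 2 * t + 1 := by omega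
        rcases (hgram i j).2 with h | h
        · rw [h, this]; exact hv1
        · rw [h, this]; exact hw1)
  exact ⟨a, b, R', by simpa using e1, by simpa using e2, e3⟩

/-- A nonzero entry `(p, q)` of `Z ^ (k - 1)` makes `e_q` cyclic. Independence of its chain follows
by pairing it with the chain of `Zᵀ` from `e_p`, which gives an antitriangular matrix. -/
theorem exists_isUnit_mul_shiftMatrix {k : ℕ} {Z : Matrix (Fin k) (Fin k) ℂ} (h0 : Z ^ k = 0)
    (h1 : Z ^ (k - 1) ≠ 0) :
    ∃ S : Matrix (Fin k) (Fin k) ℂ, IsUnit S.det ∧ S * shiftMatrix k k 1 = Z * S := by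
  obtain ⟨p, q, hpq⟩ : ∃ p q, (Z ^ (k - 1)) p q ≠ 0 := by
    by_contra! h
    exact h1 (by ext i j; exact h i j)
  have hz : ∀ j, k ≤ j → Z ^ j = 0 := fun j hj => by
    rw [← Nat.add_sub_cancel' hj, pow_add, h0, zero_mul]
  set v : ℕ → Fin k → ℂ := fun j => Z ^ j *ᵥ Pi.single q 1 with hv
  set w : ℕ → Fin k → ℂ := fun j => (Z ^ j)ᵀ *ᵥ Pi.single p 1 with hw
  have hwv : ∀ i j, w i ⬝ᵥ v j = (Z ^ (i + j)) p q := fun i j => by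
    rw [hw, mulVec_dotProduct, transpose_transpose, hv, mulVec_mulVec, ← pow_add]
    simp
  have hu : IsUnit ((colMatrix w k)ᵀ * colMatrix v k).det := by
    refine isUnit_det_of_antitriangular _ (fun i j hij => ?_) fun i j hij => ?_
    · rw [colMatrix_transpose_mul_apply, hwv, hz _ hij]; rfl
    · rw [colMatrix_transpose_mul_apply, hwv, show (i : ℕ) + j = k - 1 by omega]; exact hpq
  rw [det_mul] at hu
  refine ⟨colMatrix v k, isUnit_of_mul_isUnit_right hu, ?_⟩
  rw [mul_colMatrix, colMatrix_mul_shiftMatrix]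
  · simp only [hv, mulVec_mulVec, ← pow_succ']
  · intro j hj _
    simp only [hv, hz j hj, zero_mulVec]

/-- The left pair is what `R` and `Rᵀ` look like on a Jordan chain of `R * Rᵀ` and its image under
`Rᵀ`. It becomes symmetric because `(lam + N) ^ 2 - lam ^ 2 = N * (2 * lam + N)` is again a single
nilpotent Jordan block. -/
theorem pairEquiv_smul_one_add_shiftMatrix {lam : ℂ} (hl : lam ≠ 0) {k : ℕ} (hk : 0 < k) :
    PairEquiv (lam ^ 2 • 1 + shiftMatrix k k 1) 1 (lam • 1 + shiftMatrix k k 1)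
      (lam • 1 + shiftMatrix k k 1) := by
  set N := shiftMatrix k k 1 with hN
  have hNn : IsNilpotent N := isNilpotent_shiftMatrix _ _ one_pos
  have hu : IsUnit ((2 * lam) • 1 + N) := isUnit_smul_one_add (by simpa using hl) hNn
  have hcomm : Commute N ((2 * lam) • 1 + N) := by
    simp [Commute, SemiconjBy, Matrix.mul_add, Matrix.add_mul]
  obtain ⟨S, hS, hSN⟩ := exists_isUnit_mul_shiftMatrix (Z := N * ((2 * lam) • 1 + N)) (k := k) (by
      rw [hcomm.mul_pow, hN, shiftMatrix_pow]
      rw [show shiftMatrix k k (k * 1) = 0 by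
        ext i j
        have := i.isLt
        rw [shiftMatrix, of_apply, if_neg (by omega), Matrix.zero_apply], zero_mul]) (by
      intro h
      have := congrArg Matrix.rank h
      rw [hcomm.mul_pow, rank_mul_eq_left_of_isUnit_det _ _
        ((isUnit_iff_isUnit_det _).1 (hu.pow _)), hN, shiftMatrix_pow, rank_shiftMatrix,
        rank_zero] at this
      omega)
  have hT : IsUnit ((lam • 1 + N) * S).det := by
    rw [det_mul]
    exact ((isUnit_iff_isUnit_det _).1 (isUnit_smul_one_add hl hNn)).mul hS
  refine ⟨S, S⁻¹, (lam • 1 + N) * S, ((lam • 1 + N) * S)⁻¹, nonsing_inv_mul _ hS,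
    mul_nonsing_inv _ hS, nonsing_inv_mul _ hT, mul_nonsing_inv _ hT, ?_, Matrix.mul_one _⟩
  rw [Matrix.mul_add, hSN, ← Matrix.mul_assoc, Matrix.mul_smul, Matrix.mul_one]
  have : (lam • 1 + N) * (lam • 1 + N) = lam ^ 2 • 1 + N * ((2 * lam) • 1 + N) := by
    simp only [Matrix.add_mul, Matrix.mul_add, Matrix.smul_mul, Matrix.mul_smul, Matrix.one_mul,
      Matrix.mul_one]
    module
  rw [this, Matrix.add_mul, Matrix.smul_mul, Matrix.one_mul]

theorem exists_split_jordan (R : Matrix m n ℂ) {lam : ℂ} (hl : lam ≠ 0) (x : m → ℂ)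
    {k : ℕ} (hk : 0 < k)
    (h0 : x ⬝ᵥ ((R * Rᵀ - lam ^ 2 • (1 : Matrix m m ℂ)) ^ (k - 1) *ᵥ x) ≠ 0)
    (h1 : (R * Rᵀ - lam ^ 2 • (1 : Matrix m m ℂ)) ^ k *ᵥ x = 0) :
    ∃ (a b : ℕ) (R' : Matrix (Fin a) (Fin b) ℂ), Fintype.card m = k + a ∧
      Fintype.card n = k + b ∧ OrthEquiv R (fromBlocks (symJordan lam k) 0 0 R') := by
  set D := R * Rᵀ - lam ^ 2 • (1 : Matrix m m ℂ) with hD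
  have hDt : Dᵀ = D := by simp [hD]
  set v : ℕ → m → ℂ := fun j => D ^ j *ᵥ x with hv
  have hz : ∀ j, k ≤ j → v j = 0 := fun j hj => by
    rw [hv, ← Nat.sub_add_cancel hj]
    simp only [pow_add, ← mulVec_mulVec, h1, mulVec_zero]
  have hvv : ∀ i j, v i ⬝ᵥ v j = x ⬝ᵥ v (i + j) := pow_mulVec_dotProduct hDt x
  set P := colMatrix v k with hP
  have hDP : D * P = P * shiftMatrix k k 1 := by
    rw [hP, mul_colMatrix, colMatrix_mul_shiftMatrix _ _ _ _ fun j hj _ => hz j hj]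
    simp only [hv, mulVec_mulVec, ← pow_succ']
  have hMP : R * (Rᵀ * P) = P * (lam ^ 2 • 1 + shiftMatrix k k 1) := by
    rw [Matrix.mul_add, ← hDP, hD, Matrix.sub_mul, Matrix.mul_assoc]
    simp
  have hPu : IsUnit (Pᵀ * P).det := by
    refine isUnit_det_of_antitriangular _ (fun i j hij => ?_) fun i j hij => ?_
    · rw [hP, colMatrix_transpose_mul_apply, hvv, hz _ hij]; simp
    · rw [hP, colMatrix_transpose_mul_apply, hvv, show (i : ℕ) + j = k - 1 by omega]; exact h0
  obtain ⟨a, b, R', e1, e2, e3⟩ := exists_orthEquiv_fromBlocks_of_pairEquiv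
    (P := P) (Q := Rᵀ * P) (R := R)
    ((pairEquiv_smul_one_add_shiftMatrix hl hk).trans (pairEquiv_symJordan lam k)) hMP
    -- The Gram matrix of `Rᵀ * P` is `(Pᵀ * P) * (lam ^ 2 + N)`, a product of invertible matrices.
    (Matrix.mul_one _).symm hPu (by
      rw [transpose_mul, transpose_transpose, Matrix.mul_assoc, hMP, ← Matrix.mul_assoc, det_mul]
      exact hPu.mul ((isUnit_iff_isUnit_det _).1 (isUnit_smul_one_add (pow_ne_zero 2 hl)
        (isNilpotent_shiftMatrix _ _ one_pos))))
  exact ⟨a, b, R', by simpa using e1, by simpa using e2, e3⟩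

/-- Write the minimal polynomial as `(X - mu) ^ (k + 1) * q` with `q(mu) ≠ 0`. It does not divide
`(X - mu) ^ k * q ^ 2`, so the symmetric matrix obtained by evaluating the latter at `M` has a
nonzero value at some `y`; take `q(M) y`. -/
theorem exists_generalized_eigenvector {M : Matrix m m ℂ} (hM : Mᵀ = M) {mu : ℂ}
    (h : (minpoly ℂ M).IsRoot mu) :
    ∃ (k : ℕ) (x : m → ℂ), 1 ≤ k ∧
      x ⬝ᵥ ((M - mu • (1 : Matrix m m ℂ)) ^ (k - 1) *ᵥ x) ≠ 0 ∧
      (M - mu • (1 : Matrix m m ℂ)) ^ k *ᵥ x = 0 := by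
  have hint : IsIntegral ℂ M := Algebra.IsIntegral.isIntegral M
  have hne := minpoly.ne_zero hint
  obtain ⟨q, hq, hnd⟩ := exists_eq_pow_rootMultiplicity_mul_and_not_dvd _ hne mu
  have hk : 1 ≤ rootMultiplicity mu (minpoly ℂ M) := (rootMultiplicity_pos hne).2 h
  obtain ⟨k, hk'⟩ : ∃ k, rootMultiplicity mu (minpoly ℂ M) = k + 1 :=
    ⟨_, (Nat.sub_add_cancel hk).symm⟩
  rw [hk'] at hq
  have hq0 : q ≠ 0 := by rintro rfl; simp at hnd
  have hD : aeval M (X - C mu) = M - mu • (1 : Matrix m m ℂ) := by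
    simp [Algebra.algebraMap_eq_smul_one]
  have hg : aeval M ((X - C mu) ^ k * q ^ 2) ≠ 0 := by
    intro h0
    have hd := minpoly.dvd ℂ M h0
    rw [hq, pow_succ, mul_assoc, mul_dvd_mul_iff_left (pow_ne_zero _ (X_sub_C_ne_zero mu)), sq,
      mul_dvd_mul_iff_right hq0] at hd
    exact hnd hd
  obtain ⟨y, hy⟩ := exists_dotProduct_mulVec_ne_zero (transpose_aeval hM _) hg
  refine ⟨k + 1, aeval M q *ᵥ y, by omega, ?_, ?_⟩
  · rw [mulVec_dotProduct, transpose_aeval hM, mulVec_mulVec, mulVec_mulVec, ← hD,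
      Nat.add_sub_cancel, ← map_pow, ← map_mul, ← map_mul]
    rw [show q * (X - C mu) ^ k * q = (X - C mu) ^ k * q ^ 2 by ring]
    exact hy
  · rw [mulVec_mulVec, ← hD, ← map_pow, ← map_mul, ← hq, minpoly.aeval, zero_mulVec]

theorem exists_pow_eq_zero {M : Matrix m m ℂ} (h : ∀ mu, (minpoly ℂ M).IsRoot mu → mu = 0) :
    ∃ d, M ^ d = 0 := by
  have hint : IsIntegral ℂ M := Algebra.IsIntegral.isIntegral M
  have hs := (IsAlgClosed.splits (minpoly ℂ M)).eq_prod_roots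
  have hr : (minpoly ℂ M).roots = Multiset.replicate (minpoly ℂ M).roots.card 0 :=
    Multiset.eq_replicate.2 ⟨rfl, fun a ha => h a ((mem_roots (minpoly.ne_zero hint)).1 ha)⟩
  rw [(minpoly.monic hint).leadingCoeff, hr] at hs
  refine ⟨(minpoly ℂ M).roots.card, ?_⟩
  have := minpoly.aeval ℂ M
  rw [hs] at this
  simpa using this

theorem exists_bilinear_ne_zero {A : Matrix m n ℂ} (h : A ≠ 0) :
    ∃ x y, x ⬝ᵥ A *ᵥ y ≠ 0 := by
  by_contra! h'
  apply h
  ext i j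
  simpa using h' (Pi.single i 1) (Pi.single j 1)

theorem exists_split_part (R : Matrix m n ℂ) (h : 0 < Fintype.card m + Fintype.card n) :
    ∃ (p : Part) (a b : ℕ) (R' : Matrix (Fin a) (Fin b) ℂ), p.IsValid ∧ 0 < p.rows + p.cols ∧
      Fintype.card m = p.rows + a ∧ Fintype.card n = p.cols + b ∧
      OrthEquiv R (fromBlocks p.toMatrix 0 0 R') := by
  by_cases hev : ∀ mu, (minpoly ℂ (R * Rᵀ)).IsRoot mu → mu = 0
  · have hRM : ∀ k, Rᵀ * (R * Rᵀ) ^ k = ((R * Rᵀ) ^ k * R)ᵀ := fun k => by simp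
    have hRN : ∀ k, (R * Rᵀ) ^ k * R = R * (Rᵀ * R) ^ k := fun k =>
      pow_intertwine (by simp [Matrix.mul_assoc]) k
    have hex : ∃ k, (R * Rᵀ) ^ k * R = 0 := by
      obtain ⟨d, hd⟩ := exists_pow_eq_zero hev
      exact ⟨d, by rw [hd, Matrix.zero_mul]⟩
    classical
    -- Minimality of `k` locates the longest nonzero words: `(R * Rᵀ) ^ k` gives a tall part, `(Rᵀ *
    -- R) ^ k` a wide one, and if both vanish `(R * Rᵀ) ^ (k - 1) * R` gives a nilpotent Jordan
    -- block of size `2 * k`.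
    set k := Nat.find hex with hk
    have hk0 : (R * Rᵀ) ^ k * R = 0 := Nat.find_spec hex
    by_cases h1 : (R * Rᵀ) ^ k = 0
    · by_cases h2 : (Rᵀ * R) ^ k = 0
      · have hkpos : k ≠ 0 := by
          intro h0
          rw [h0, pow_zero] at h1 h2
          have e1 : (1 : Matrix m m ℂ).rank = 0 := by rw [h1, rank_zero]
          have e2 : (1 : Matrix n n ℂ).rank = 0 := by rw [h2, rank_zero]
          rw [rank_one] at e1 e2
          omega
        obtain ⟨t, ht⟩ := Nat.exists_eq_succ_of_ne_zero hkpos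
        have h3 : (R * Rᵀ) ^ t * R ≠ 0 := Nat.find_min hex (by omega)
        obtain ⟨x, y, hxy⟩ := exists_bilinear_ne_zero h3
        obtain ⟨a, b, R', e1, e2, e3⟩ := exists_split_jordan_zero R x y t hxy (by rw [← h1, ht])
          (by rw [← h2, ht])
        refine ⟨.jordan 0 (2 * t + 2), a, b, R', ⟨by omega, ?_⟩, by simp [Part.rows], e1, e2, ?_⟩
        · rintro ⟨-, c, hc⟩; omega
        · have h4 : (0 : ℂ) ^ (2⁻¹ : ℂ) = 0 := by simp
          rw [← h4] at e3
          exact e3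
      · obtain ⟨x, hx⟩ := exists_dotProduct_mulVec_ne_zero (by simp) h2
        obtain ⟨a, b, R', e1, e2, e3⟩ := exists_split_tall Rᵀ x k (by simpa using hx) (by
          simp [← hRN, hk0])
        refine ⟨.wide k, b, a, R'ᵀ, trivial, by simp [Part.cols], e2, e1, ?_⟩
        have := e3.transpose
        rwa [transpose_transpose, fromBlocks_transpose, transpose_zero, transpose_zero] at this
    · obtain ⟨x, hx⟩ := exists_dotProduct_mulVec_ne_zero (by simp) h1
      obtain ⟨a, b, R', e1, e2, e3⟩ := exists_split_tall R x k hx (by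
        rw [hRM, hk0, transpose_zero])
      exact ⟨.tall k, a, b, R', trivial, by simp [Part.rows], e1, e2, e3⟩
  · push Not at hev
    obtain ⟨mu, hmu, hmu0⟩ := hev
    obtain ⟨k, x, hk, h0, h1⟩ := exists_generalized_eigenvector (by simp) hmu
    have hs : (mu ^ (2⁻¹ : ℂ)) ^ 2 = mu := by simp
    obtain ⟨a, b, R', e1, e2, e3⟩ := exists_split_jordan R (lam := mu ^ (2⁻¹ : ℂ))
      (by simpa using hmu0) x hk (by rwa [hs]) (by rwa [hs])
    exact ⟨.jordan mu k, a, b, R', ⟨hk, fun h => hmu0 h.1⟩, by simp [Part.rows]; omega,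
      e1, e2, e3⟩

theorem exists_orthEquiv_partSum (N : ℕ) : ∀ (m n : Type) [Fintype m] [Fintype n]
    [DecidableEq m] [DecidableEq n] (R : Matrix m n ℂ), Fintype.card m + Fintype.card n = N →
    ∃ L : List Part, (∀ p ∈ L, p.IsValid) ∧ OrthEquiv R (partSum L) := by
  induction N using Nat.strong_induction_on with
  | _ N ih =>
    intro m n _ _ _ _ R hN
    rcases Nat.eq_zero_or_pos N with rfl | hpos
    · have : IsEmpty m := Fintype.card_eq_zero_iff.1 (by omega)
      have : IsEmpty n := Fintype.card_eq_zero_iff.1 (by omega)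
      have : IsEmpty (Fin (sumRows [])) := Fin.isEmpty
      have : IsEmpty (Fin (sumCols [])) := Fin.isEmpty
      exact ⟨[], by simp, .of_isEmpty _ _⟩
    · obtain ⟨p, a, b, R', hp, hp0, e1, e2, e3⟩ := exists_split_part R (by omega)
      obtain ⟨L, hL, hR'⟩ := ih (a + b) (by omega) (Fin a) (Fin b) R' (by simp)
      refine ⟨p :: L, ?_, e3.trans (((OrthEquiv.refl _).fromBlocks hR').trans
        (partSum_cons p L))⟩
      intro q hq
      rcases List.mem_cons.1 hq with rfl | hq
      · exact hp
      · exact hL q hq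

end Chains

/-! ### From parts to blocks -/

section Blocks

/-- The splitting theorem applied to identity frames: the summand exhausts both spaces, so the
complement has size zero. -/
theorem OrthEquiv.of_pairEquiv {m n m' n' : Type} [Fintype m] [Fintype n] [Fintype m'] [Fintype n']
    [DecidableEq m] [DecidableEq n] [DecidableEq m'] [DecidableEq n'] {R : Matrix m n ℂ}
    {R' : Matrix m' n' ℂ} (h : PairEquiv R Rᵀ R' R'ᵀ) : OrthEquiv R R' := by
  obtain ⟨a, b, S, e1, e2, e3⟩ := exists_orthEquiv_fromBlocks_of_pairEquiv (P := 1) (Q := 1)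
    (R := R) h (by simp) (by simp) (by simp) (by simp)
  obtain ⟨P, P', Q, Q', h1, h2, h3, h4, -⟩ := h
  have card_eq : ∀ {m m' : Type} [Fintype m] [Fintype m'] [DecidableEq m] [DecidableEq m']
      {P : Matrix m' m ℂ} {P' : Matrix m m' ℂ}, P' * P = 1 →
      Fintype.card m ≤ Fintype.card m' := by
    intro m m' _ _ _ _ P P' hP
    have := rank_mul_le_right P' P
    rw [hP, rank_one] at this
    exact this.trans P.rank_le_card_height
  have := card_eq h1
  have := card_eq h2
  have := card_eq h3
  have := card_eq h4
  obtain rfl : a = 0 := by omega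
  obtain rfl : b = 0 := by omega
  refine e3.trans ?_
  convert OrthEquiv.reindex (Matrix.fromBlocks R' 0 0 S) (Equiv.sumEmpty m' (Fin 0))
    (Equiv.sumEmpty n' (Fin 0)) using 1
  rfl

/-- Alternating signs `D` anticommute with the shift `N`, so `D` on one space and `-D` on the other
carry `lam + N` to `-lam + N`. -/
theorem orthEquiv_symJordan_neg (lam : ℂ) (m : ℕ) :
    OrthEquiv (symJordan lam m) (symJordan (-lam) m) := by
  refine .of_pairEquiv ((pairEquiv_symJordan lam m).symm.trans
    (PairEquiv.trans ?_ (pairEquiv_symJordan (-lam) m)))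
  set D : Matrix (Fin m) (Fin m) ℂ := diagonal fun i => (-1) ^ (i : ℕ) with hD
  have hDD : D * D = 1 := by
    rw [hD, diagonal_mul_diagonal, ← diagonal_one]
    congr 1
    ext i
    rw [← mul_pow]; simp
  have hDN : D * shiftMatrix m m 1 = -(shiftMatrix m m 1 * D) := by
    ext i j
    rw [hD, diagonal_mul, neg_apply, mul_diagonal, shiftMatrix, of_apply]
    split_ifs with h
    · rw [h]; ring
    · simp
  refine ⟨D, D, -D, -D, hDD, hDD, by simpa using hDD, by simpa using hDD, ?_, ?_⟩
  · rw [Matrix.mul_add, Matrix.add_mul, hDN]; simp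
  · rw [Matrix.mul_add, Matrix.add_mul, Matrix.neg_mul, Matrix.neg_mul, hDN]; simp

/-- Separates the even coordinates from the odd ones. -/
noncomputable def evenOddEquiv (k : ℕ) : Fin (k + 1) ⊕ Fin k ≃ Fin (2 * k + 1) :=
  Equiv.ofBijective
    (Sum.elim (fun p => ⟨2 * (p : ℕ), by have := p.isLt; omega⟩)
      (fun q => ⟨2 * (q : ℕ) + 1, by have := q.isLt; omega⟩))
    ((Fintype.bijective_iff_injective_and_card _).2 ⟨by
      rintro (p | p) (q | q) h <;> simp [Fin.ext_iff] at h ⊢ <;> omega, by simp; omega⟩)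

/-- For odd size, all three conditions defining nonzero entries force the two indices to have
opposite parity; sorting rows and columns by parity therefore decouples the matrix. -/
theorem orthEquiv_symNilpotent_odd (k : ℕ) :
    OrthEquiv (symNilpotent (2 * k + 1)) (fromBlocks (oddEven k) 0 0 (oddEven k)ᵀ) := by
  convert OrthEquiv.reindex (symNilpotent (2 * k + 1)) (evenOddEquiv k).symm
    ((evenOddEquiv k).symm.trans (Equiv.sumComm _ _)) using 1
  ext (i | i) (j | j)
  · rfl
  · simp only [fromBlocks_apply₁₂, reindex_apply, submatrix_apply, Matrix.zero_apply]
    change 0 = symEntry (2 * k + 1) (2 * i) (2 * j)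
    rw [symEntry, if_neg (by omega), if_neg (by omega), if_neg (by omega)]; simp
  · simp only [fromBlocks_apply₂₁, reindex_apply, submatrix_apply, Matrix.zero_apply]
    change 0 = symEntry (2 * k + 1) (2 * i + 1) (2 * j + 1)
    rw [symEntry, if_neg (by omega), if_neg (by omega), if_neg (by omega)]; simp
  · exact symEntry_comm _ _ _

theorem partSum_singleton (p : Part) : OrthEquiv p.toMatrix (partSum [p]) := by
  refine OrthEquiv.trans ?_ (partSum_cons p [])
  let e : Fin p.rows ≃ Fin p.rows ⊕ Fin (sumRows []) := (Equiv.sumEmpty _ (Fin 0)).symm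
  let f : Fin p.cols ≃ Fin p.cols ⊕ Fin (sumCols []) := (Equiv.sumEmpty _ (Fin 0)).symm
  convert OrthEquiv.reindex p.toMatrix e f using 1
  ext (i | i) (j | j)
  · rfl
  · exact j.elim0
  · exact i.elim0
  · exact i.elim0

theorem partSum_pair (p q : Part) :
    OrthEquiv (fromBlocks p.toMatrix 0 0 q.toMatrix) (partSum [p, q]) :=
  ((OrthEquiv.refl _).fromBlocks (partSum_singleton q)).trans (partSum_cons p [q])

open Classical in
/-- The constituents of a block, as a list. -/
noncomputable def Block.partList : Block → List Part
  | .jordan lam m _ =>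
    if lam = 0 ∧ Odd m then [Part.tall (m / 2), Part.wide (m / 2)] else [Part.jordan (lam ^ 2) m]
  | .degenerate k l => [Part.tall k, Part.wide l]

theorem Block.coe_partList (b : Block) : (b.partList : Multiset Part) = b.parts := by
  cases b with
  | jordan lam m hm =>
    simp only [Block.partList, Block.parts]
    split_ifs <;> rfl
  | degenerate k l => rfl

theorem coe_flatMap_partList (L : List Block) :
    (L.flatMap Block.partList : Multiset Part) = parts L := by
  induction L with
  | nil => rfl
  | cons b L ih =>
    rw [List.flatMap_cons, ← Multiset.coe_add, ih, Block.coe_partList]; simp [parts]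

theorem Block.isValid_of_mem_partList {b : Block} {p : Part} (h : p ∈ b.partList) : p.IsValid := by
  cases b with
  | jordan lam m hm =>
    simp only [Block.partList] at h
    split_ifs at h with h0
    · simp only [List.mem_cons, List.not_mem_nil, or_false] at h
      rcases h with rfl | rfl <;> trivial
    · simp only [List.mem_cons, List.not_mem_nil, or_false] at h
      subst h
      exact ⟨hm, by simpa using h0⟩
  | degenerate k l =>
    simp only [Block.partList, List.mem_cons, List.not_mem_nil, or_false] at h
    rcases h with rfl | rfl <;> trivial

theorem Block.orthEquiv_partSum (b : Block) : OrthEquiv b.toMatrix (partSum b.partList) := by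
  cases b with
  | jordan lam m hm =>
    by_cases h : lam = 0 ∧ Odd m
    · obtain ⟨rfl, k, rfl⟩ := h
      have hlist : (Block.jordan 0 (2 * k + 1) hm).partList = [Part.tall k, Part.wide k] := by
        rw [Block.partList, if_pos ⟨rfl, k, rfl⟩, show (2 * k + 1) / 2 = k by omega]
      rw [hlist]
      refine OrthEquiv.trans ?_ (partSum_pair _ _)
      have := orthEquiv_symNilpotent_odd k
      rw [show symNilpotent (2 * k + 1) = symJordan 0 (2 * k + 1) by simp [symJordan]] at this
      exact this
    · have hlist : (Block.jordan lam m hm).partList = [Part.jordan (lam ^ 2) m] := by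
        rw [Block.partList, if_neg h]
      rw [hlist]
      refine OrthEquiv.trans ?_ (partSum_singleton _)
      change OrthEquiv (symJordan lam m) (symJordan ((lam ^ 2) ^ (2⁻¹ : ℂ)) m)
      -- The chosen root of `lam ^ 2` is `lam` or `-lam`.
      have hs : ((lam ^ 2) ^ (2⁻¹ : ℂ)) ^ 2 = lam ^ 2 := by simp
      rcases sq_eq_sq_iff_eq_or_eq_neg.1 hs with h1 | h1
      · rw [h1]; exact .refl _
      · rw [h1]; exact orthEquiv_symJordan_neg lam m
  | degenerate k l => exact (OrthEquiv.reindex _ _ _).symm.trans (partSum_pair (.tall k) (.wide l))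

theorem directSum_orthEquiv_partSum (L : List Block) :
    OrthEquiv (directSum L) (partSum (L.flatMap Block.partList)) := by
  induction L with
  | nil =>
    have : IsEmpty (Fin (totalSize [])) := Fin.isEmpty
    have : IsEmpty (Fin (sumRows ([].flatMap Block.partList))) := Fin.isEmpty
    have : IsEmpty (Fin (sumCols ([].flatMap Block.partList))) := Fin.isEmpty
    exact .of_isEmpty _ _
  | cons b L ih =>
    have h : OrthEquiv (fromBlocks b.toMatrix 0 0 (directSum L)) (directSum (b :: L)) :=
      OrthEquiv.reindex _ _ _
    exact h.symm.trans ((b.orthEquiv_partSum.fromBlocks ih).trans (partSum_append _ _))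

theorem hasForm_iff_orthEquiv {n : ℕ} (R : Matrix (Fin n) (Fin n) ℂ) (L : List Block) :
    HasForm R L ↔ OrthEquiv R (directSum L) := by
  constructor
  · rintro ⟨rfl, O₁, O₂, h1, h2, h⟩
    have h1' := mul_eq_one_comm.1 h1
    have h2' := mul_eq_one_comm.1 h2
    refine ⟨O₁, O₂ᵀ, h1, h1', by simpa using h2', by simpa using h2, ?_⟩
    have h3 : O₁ * R * O₂ = directSum L := h
    rw [← h3, Matrix.mul_assoc (O₁ * R), h2', Matrix.mul_one]
  · intro h
    obtain rfl : totalSize L = n := by simpa using h.card_rows.symm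
    obtain ⟨P, Q, h1, h2, h3, h4, h5⟩ := h
    refine ⟨rfl, P, Qᵀ, h1, by simpa using h4, ?_⟩
    rw [h5, Matrix.mul_assoc, h4, Matrix.mul_one]
    rfl

theorem sumRows_eq_of_perm {L L' : List Part} (h : L.Perm L') : sumRows L = sumRows L' := by
  simpa using (OrthEquiv.partSum_of_perm h).card_rows

theorem sumCols_eq_of_perm {L L' : List Part} (h : L.Perm L') : sumCols L = sumCols L' := by
  simpa using (OrthEquiv.partSum_of_perm h).card_cols

theorem sumRows_eq_of_forall_tall {L : List Part} (h : ∀ p ∈ L, ∃ k, p = .tall k) :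
    sumRows L = sumCols L + L.length := by
  induction L with
  | nil => rfl
  | cons p L ih =>
    obtain ⟨k, rfl⟩ := h p (by simp)
    have := ih fun q hq => h q (by simp [hq])
    simp only [sumRows, sumCols, Part.rows, Part.cols, List.length_cons]
    omega

theorem sumCols_eq_of_forall_wide {L : List Part} (h : ∀ p ∈ L, ∃ k, p = .wide k) :
    sumCols L = sumRows L + L.length := by
  induction L with
  | nil => rfl
  | cons p L ih =>
    obtain ⟨k, rfl⟩ := h p (by simp)
    have := ih fun q hq => h q (by simp [hq])
    simp only [sumRows, sumCols, Part.rows, Part.cols, List.length_cons]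
    omega

/-- Valid parts with as many rows as columns in total are the constituents of some blocks. -/
theorem exists_parts_eq (N : ℕ) : ∀ L : List Part, L.length = N → (∀ p ∈ L, p.IsValid) →
    sumRows L = sumCols L → ∃ B : List Block, parts B = L := by
  classical
  induction N using Nat.strong_induction_on with
  | _ N ih =>
    intro L hN hL hs
    by_cases hJ : ∃ mu m, Part.jordan mu m ∈ L
    · obtain ⟨mu, m, hm⟩ := hJ
      have hp := List.perm_cons_erase hm
      have hlen := hp.length_eq
      have hr := sumRows_eq_of_perm hp
      have hc := sumCols_eq_of_perm hp
      simp only [sumRows, sumCols, Part.rows, Part.cols, List.length_cons] at hr hc hlen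
      obtain ⟨B, hB⟩ := ih _ (by omega) (L.erase (.jordan mu m)) rfl
        (fun p h => hL p (List.mem_of_mem_erase h)) (by omega)
      obtain ⟨h1, h2⟩ := hL _ hm
      refine ⟨.jordan (mu ^ (2⁻¹ : ℂ)) m h1 :: B, ?_⟩
      have hb : (Block.jordan (mu ^ (2⁻¹ : ℂ)) m h1).parts = {Part.jordan mu m} := by
        have h3 : ¬(mu ^ (2⁻¹ : ℂ) = 0 ∧ Odd m) := by simpa using h2
        simp only [Block.parts, if_neg h3]
        simp
      rw [Multiset.coe_eq_coe.2 hp, ← Multiset.cons_coe, ← hB, ← Multiset.singleton_add, ← hb]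
      simp [parts]
    · push Not at hJ
      have hTW : ∀ p ∈ L, (∃ k, p = .tall k) ∨ ∃ k, p = .wide k := by
        intro p hp
        cases p with
        | jordan mu m => exact absurd hp (hJ mu m)
        | tall k => exact .inl ⟨k, rfl⟩
        | wide k => exact .inr ⟨k, rfl⟩
      rcases L.eq_nil_or_concat with rfl | ⟨_, _, hne⟩
      · exact ⟨[], rfl⟩
      have hpos : 0 < L.length := by rw [hne]; simp
      -- Each tall part has one row too many and each wide part one column too many; squareness thus
      -- forces both kinds to occur, and any two can be paired.
      have hT : ∃ k, Part.tall k ∈ L := by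
        by_contra! h
        have := sumCols_eq_of_forall_wide (L := L) fun p hp =>
          (hTW p hp).resolve_left (by rintro ⟨k, rfl⟩; exact h k hp)
        omega
      have hW : ∃ k, Part.wide k ∈ L := by
        by_contra! h
        have := sumRows_eq_of_forall_tall (L := L) fun p hp =>
          (hTW p hp).resolve_right (by rintro ⟨k, rfl⟩; exact h k hp)
        omega
      obtain ⟨k, hk⟩ := hT
      obtain ⟨l, hl⟩ := hW
      have hl' : Part.wide l ∈ L.erase (.tall k) := (List.mem_erase_of_ne (by simp)).2 hl
      have hp := (List.perm_cons_erase hk).trans ((List.perm_cons_erase hl').cons _)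
      have hlen := hp.length_eq
      have hr := sumRows_eq_of_perm hp
      have hc := sumCols_eq_of_perm hp
      simp only [sumRows, sumCols, Part.rows, Part.cols, List.length_cons] at hr hc hlen
      obtain ⟨B, hB⟩ := ih _ (by omega) ((L.erase (.tall k)).erase (.wide l)) rfl
        (fun p h => hL p (List.mem_of_mem_erase (List.mem_of_mem_erase h))) (by omega)
      refine ⟨.degenerate k l :: B, ?_⟩
      rw [Multiset.coe_eq_coe.2 hp, ← Multiset.cons_coe, ← Multiset.cons_coe, ← hB]
      simp [parts, Block.parts]

end Blocks

end ComplexOrthogonalSVD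

theorem theorem1 (n : ℕ) (R : Matrix (Fin n) (Fin n) ℂ) :
    (∃ L : List ComplexOrthogonalSVD.Block, ComplexOrthogonalSVD.HasForm R L) ∧
    (∀ L L' : List ComplexOrthogonalSVD.Block, ComplexOrthogonalSVD.HasForm R L →
      (ComplexOrthogonalSVD.HasForm R L' ↔
        ComplexOrthogonalSVD.parts L' = ComplexOrthogonalSVD.parts L)) := by
  open ComplexOrthogonalSVD in
  have hvalid : ∀ L : List Block, ∀ p ∈ L.flatMap Block.partList, p.IsValid := by
    intro L p hp
    obtain ⟨b, -, hb⟩ := List.mem_flatMap.1 hp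
    exact Block.isValid_of_mem_partList hb
  simp only [hasForm_iff_orthEquiv]
  constructor
  · obtain ⟨P, hP, hR⟩ := exists_orthEquiv_partSum _ _ _ R rfl
    have hr := hR.card_rows
    have hc := hR.card_cols
    simp only [Fintype.card_fin] at hr hc
    obtain ⟨B, hB⟩ := exists_parts_eq _ P rfl hP (hr.symm.trans hc)
    rw [← coe_flatMap_partList, Multiset.coe_eq_coe] at hB
    exact ⟨B, hR.trans ((directSum_orthEquiv_partSum B).trans
      (OrthEquiv.partSum_of_perm hB)).symm⟩
  · intro L L' h
    rw [← coe_flatMap_partList, ← coe_flatMap_partList, Multiset.coe_eq_coe]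
    constructor
    · intro h'
      exact OrthEquiv.perm_of_partSum (hvalid L') (hvalid L)
        ((directSum_orthEquiv_partSum L').symm.trans
          ((h'.symm.trans h).trans (directSum_orthEquiv_partSum L)))
    · intro hp
      exact h.trans ((directSum_orthEquiv_partSum L).trans
        ((OrthEquiv.partSum_of_perm hp.symm).trans (directSum_orthEquiv_partSum L').symm))
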